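/- A vertical tribracket is a set $X$ with a ternary operation $\langle x,y,z\rangle$ such that (i) for all $x,y,z\in X$ there are unique $u,v,w\in X$ with $\langle x,y,u\rangle=z$, $\langle x,v,y\rangle=z$ and $\langle w,x,y\rangle=z$, and (ii) for all $x,y,z,w\in X$, $$\langle x,\langle x,y,z\rangle,\langle\langle x,y,z\rangle,z,w\rangle\rangle=\langle x,y,\langle y,z,w\rangle\rangle,\qquad \langle\langle x,y,z\rangle,z,w\rangle=\langle\langle x,y,\langle y,z,w\rangle\rangle,\langle y,z,w\rangle,w\rangle .$$ It is center-involutory if for all $x,y\in X$ the map $a\mapsto\langle x,a,y\rangle$ is an involution. Let $D$ be an oriented link diagram: finitely many oriented closed polygons in the plane, in general position (the only singularities are transverse double points interior to two edges), with a choice of upper strand at each crossing. An $X$-coloring of $D$ assigns an element of $X$ to each region (connected component of the complement of the polygons in the plane) so that the following holds at each crossing. Looking along the two outgoing strands, let $l$, $r$, $b$, $f$ be the colors of the regions to the left, to the right, behind (between the incoming strands) and in front (between the outgoing strands); then $f=\langle l,b,r\rangle$ if the crossing is positive and $b=\langle l,f,r\rangle$ if it is negative. Proposition. Let $X$ be a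 center-involutory vertical tribracket and let $D$ be an oriented link diagram with $c$ components. Then the number (cardinality) of $X$-colorings of $D$ equals that of the standard crossingless diagram of the $c$-component unlink, namely $|X|^{c+1}$. -/

import Mathlib

universe u

/-- A vertical tribracket structure on `X`: a ternary operation `⟨x, y, z⟩` that is uniquely
solvable in each of its three places and satisfies the two exchange identities. -/
structure VerticalTribracket (X : Type u) where
  br : X → X → X → X
  right_inv : ∀ x y z, ∃! t, br x y t = z
  center_inv : ∀ x y z, ∃! t, br x t y = z
  left_inv : ∀ x y z, ∃! t, br t x y = z
  exchange₁ : ∀ x y z w,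
    br x (br x y z) (br (br x y z) z w) = br x y (br y z w)
  exchange₂ : ∀ x y z w,
    br (br x y z) z w = br (br x y (br y z w)) (br y z w) w

/-- All the maps `a ↦ ⟨x, a, y⟩` are involutions. -/
def VerticalTribracket.CenterInvolutory {X : Type u} (T : VerticalTribracket X) : Prop :=
  ∀ x y : X, Function.Involutive fun a => T.br x a y

/-- Finitely many oriented closed polygons in the plane, with no position requirement yet.
The edge `i` runs from `pt i` to `pt (next i)`, and is followed by the edge `next i`; the closed
polygons are the cycles of the permutation `next`. -/
structure OrientedPolygons where
  Edge : Type
  finite_edge : Finite Edge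
  next : Equiv.Perm Edge
  pt : Edge → ℝ × ℝ

namespace OrientedPolygons

variable (P : OrientedPolygons)

/-- The closed segment covered by an edge. -/
def side (i : P.Edge) : Set (ℝ × ℝ) := segment ℝ (P.pt i) (P.pt (P.next i))

/-- The direction in which an edge is traversed. -/
def dir (i : P.Edge) : ℝ × ℝ := P.pt (P.next i) - P.pt i

/-- Two edges that are neither equal nor consecutive meet. -/
def Crosses (i j : P.Edge) : Prop :=
  i ≠ j ∧ P.next i ≠ j ∧ P.next j ≠ i ∧ (P.side i ∩ P.side j).Nonempty

/-- The closed polygons. -/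
def Component : Type := Quotient (Equiv.Perm.SameCycle.setoid P.next)

noncomputable def numComponents : ℕ := Nat.card P.Component

/-- The complement in the plane of the union of all polygons. -/
def complement : Set (ℝ × ℝ) := (⋃ i, P.side i)ᶜ

/-- The regions: the connected components of the planar complement. -/
def Region : Type := ConnectedComponents P.complement

/-- Starting at `p` and moving a little in the direction `d` leads into the region `r`. -/
def LeadsInto (p d : ℝ × ℝ) (r : P.Region) : Prop :=
  ∀ᶠ ε in nhdsWithin (0 : ℝ) (Set.Ioi 0),
    ∃ h : p + ε • d ∈ P.complement, ConnectedComponents.mk (⟨p + ε • d, h⟩ : P.complement) = r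

end OrientedPolygons

/-- `cross2 a b > 0` means that `b` points to the left of `a`. -/
def cross2 (a b : ℝ × ℝ) : ℝ := a.1 * b.2 - a.2 * b.1

/-- An oriented link diagram: oriented closed polygons in general position in the plane (so that
the only singularities are finitely many transverse double points, interior to two edges),
together with the choice of the upper strand at each crossing. -/
structure LinkDiagram extends OrientedPolygons where
  next_ne : ∀ i, next i ≠ i
  pt_injective : Function.Injective pt
  pt_mem_side : ∀ i j, pt j ∈ toOrientedPolygons.side i → j = i ∨ j = next i
  side_inter_side : ∀ i j, i ≠ j →
    (toOrientedPolygons.side i ∩ toOrientedPolygons.side j).Subsingleton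
  no_triple_point : ∀ i j k, i ≠ j → j ≠ k → i ≠ k →
    toOrientedPolygons.side i ∩ toOrientedPolygons.side j ∩ toOrientedPolygons.side k = ∅
  /-- `upper i j`: at the crossing of the edges `i` and `j`, the edge `i` is the upper strand. -/
  upper : Edge → Edge → Prop
  upper_iff : ∀ i j, toOrientedPolygons.Crosses i j → (upper i j ↔ ¬ upper j i)

namespace LinkDiagram

/-- A coloring of the regions of `D` by a vertical tribracket. Look at a crossing along its two
outgoing strands: there are a left region `l`, a right region `r`, a region `b` behind (between
the two incoming strands) and a region `f` in front (between the two outgoing strands).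
At a positive crossing the colors satisfy `f = ⟨l, b, r⟩`, at a negative one `b = ⟨l, f, r⟩`.
In `positive` and `negative`, the edge `i` is the upper strand and `j` the lower one. -/
structure Coloring (D : LinkDiagram) {X : Type u} (T : VerticalTribracket X) where
  color : D.Region → X
  positive : ∀ i j p, D.Crosses i j → D.upper i j → p ∈ D.side i ∩ D.side j →
    0 < cross2 (D.dir i) (D.dir j) →
    ∃ l b r f : D.Region,
      D.LeadsInto p (D.dir j - D.dir i) l ∧ D.LeadsInto p (-D.dir i - D.dir j) b ∧
      D.LeadsInto p (D.dir i - D.dir j) r ∧ D.LeadsInto p (D.dir i + D.dir j) f ∧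
      color f = T.br (color l) (color b) (color r)
  negative : ∀ i j p, D.Crosses i j → D.upper i j → p ∈ D.side i ∩ D.side j →
    cross2 (D.dir i) (D.dir j) < 0 →
    ∃ l b r f : D.Region,
      D.LeadsInto p (D.dir i - D.dir j) l ∧ D.LeadsInto p (-D.dir i - D.dir j) b ∧
      D.LeadsInto p (D.dir j - D.dir i) r ∧ D.LeadsInto p (D.dir i + D.dir j) f ∧
      color b = T.br (color l) (color f) (color r)

end LinkDiagram

/-- The corners of the `k`-th triangle of the standard diagram of an unlink. -/
def trianglePt (k : ℕ) : Fin 3 → ℝ × ℝ :=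
  ![(3 * (k : ℝ), 0), (3 * (k : ℝ) + 1, 0), (3 * (k : ℝ), 1)]

/-- `c` disjoint triangles next to each other. -/
def unlinkPolygons (c : ℕ) : OrientedPolygons where
  Edge := Fin c × Fin 3
  finite_edge := inferInstance
  next := Equiv.prodCongr (Equiv.refl _) (Equiv.addRight 1)
  pt := fun i => trianglePt i.1 i.2

theorem mem_side_unlinkPolygons {c : ℕ} {k : Fin c} {s : Fin 3} {q : ℝ × ℝ}
    (hq : q ∈ (unlinkPolygons c).side (k, s)) :
    3 * (k : ℝ) ≤ q.1 ∧ 0 ≤ q.2 ∧ q.1 + q.2 ≤ 3 * (k : ℝ) + 1 ∧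
      (s = 0 → q.2 = 0) ∧ (s = 1 → q.1 + q.2 = 3 * (k : ℝ) + 1) ∧
      (s = 2 → q.1 = 3 * (k : ℝ)) := by
  change q ∈ segment ℝ (trianglePt k s) (trianglePt k (s + 1)) at hq
  obtain ⟨a, b, ha, hb, hab, rfl⟩ := hq
  obtain rfl : a = 1 - b := by linarith
  refine ⟨?_, ?_, ?_, ?_, ?_, ?_⟩ <;> fin_cases s <;> simp [trianglePt] <;> nlinarith

theorem triangle_eq_of_mem {c : ℕ} {i j : Fin c × Fin 3} {q : ℝ × ℝ}
    (hi : q ∈ (unlinkPolygons c).side i) (hj : q ∈ (unlinkPolygons c).side j) : i.1 = j.1 := by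
  obtain ⟨k, s⟩ := i
  obtain ⟨l, t⟩ := j
  obtain ⟨h1, h2, h3, -⟩ := mem_side_unlinkPolygons hi
  obtain ⟨g1, g2, g3, -⟩ := mem_side_unlinkPolygons hj
  have e1 : (k : ℝ) < l + 1 := by linarith
  have e2 : (l : ℝ) < k + 1 := by linarith
  have e3 : (k : ℕ) < l + 1 := by exact_mod_cast e1
  have e4 : (l : ℕ) < k + 1 := by exact_mod_cast e2
  exact Fin.ext (Nat.le_antisymm (Nat.lt_succ_iff.mp e3) (Nat.lt_succ_iff.mp e4))

theorem pt_mem_side_unlinkPolygons {c : ℕ} (i : Fin c × Fin 3) :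
    (unlinkPolygons c).pt i ∈ (unlinkPolygons c).side i := left_mem_segment ℝ _ _
/-- The standard diagram, without crossings, of the unlink with `c` components. -/
def unlink (c : ℕ) : LinkDiagram where
  toOrientedPolygons := unlinkPolygons c
  next_ne := by
    rintro ⟨k, s⟩ h
    have h2 : s + 1 = s := congrArg Prod.snd h
    revert h2
    fin_cases s <;> decide
  pt_injective := by
    rintro ⟨k, s⟩ ⟨l, t⟩ h
    have hk : k = l := triangle_eq_of_mem (pt_mem_side_unlinkPolygons (k, s))
      (by rw [h]; exact pt_mem_side_unlinkPolygons (l, t))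
    subst hk
    fin_cases s <;> fin_cases t <;> simp_all [unlinkPolygons, trianglePt]
  pt_mem_side := by
    rintro ⟨k, s⟩ ⟨l, t⟩ h
    have hk : k = l := triangle_eq_of_mem h (pt_mem_side_unlinkPolygons (l, t))
    subst hk
    have h' := mem_side_unlinkPolygons h
    change _ ∨ _ = (k, s + 1)
    revert h'
    fin_cases s <;> fin_cases t <;> simp [unlinkPolygons, trianglePt]
  side_inter_side := by
    rintro ⟨k, s⟩ ⟨l, t⟩ hne p ⟨hp1, hp2⟩ q ⟨hq1, hq2⟩
    have hk : k = l := triangle_eq_of_mem hp1 hp2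
    subst hk
    obtain ⟨-, -, -, a0, a1, a2⟩ := mem_side_unlinkPolygons hp1
    obtain ⟨-, -, -, b0, b1, b2⟩ := mem_side_unlinkPolygons hp2
    obtain ⟨-, -, -, c0, c1, c2⟩ := mem_side_unlinkPolygons hq1
    obtain ⟨-, -, -, d0, d1, d2⟩ := mem_side_unlinkPolygons hq2
    fin_cases s <;> fin_cases t <;> first
      | exact absurd rfl hne
      | (simp at a0 a1 a2 b0 b1 b2 c0 c1 c2 d0 d1 d2
         refine Prod.ext ?_ ?_ <;> linarith)
  no_triple_point := by
    rintro ⟨k, s⟩ ⟨l, t⟩ ⟨m, r⟩ h1 h2 h3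
    refine Set.eq_empty_of_forall_notMem ?_
    rintro p ⟨⟨hp1, hp2⟩, hp3⟩
    have hk : k = l := triangle_eq_of_mem hp1 hp2
    have hm : k = m := triangle_eq_of_mem hp1 hp3
    subst hk hm
    obtain ⟨-, -, -, a0, a1, a2⟩ := mem_side_unlinkPolygons hp1
    obtain ⟨-, -, -, b0, b1, b2⟩ := mem_side_unlinkPolygons hp2
    obtain ⟨-, -, -, c0, c1, c2⟩ := mem_side_unlinkPolygons hp3
    fin_cases s <;> fin_cases t <;> fin_cases r <;> first
      | exact absurd rfl h1
      | exact absurd rfl h2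
      | exact absurd rfl h3
      | (simp at a0 a1 a2 b0 b1 b2 c0 c1 c2
         linarith)
  upper := fun _ _ => False
  upper_iff := by
    rintro ⟨k, s⟩ ⟨l, t⟩ ⟨h1, h2, h3, p, hp1, hp2⟩
    have hk : k = l := triangle_eq_of_mem hp1 hp2
    subst hk
    exfalso
    change (k, s + 1) ≠ (k, t) at h2
    change (k, t + 1) ≠ (k, s) at h3
    fin_cases s <;> fin_cases t <;> first
      | exact absurd rfl h1
      | exact absurd rfl h2
      | exact absurd rfl h3

/-! Give each region, besides its color x, one further color y_k per component k: the color that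
would lie across an extra "virtual" edge of k having the region on its right. Crossing an edge of k
from right to left turns this virtual edge into a real one. The new color is y_k, and the virtual
color y_j becomes the element z' with ⟨z', y_k, x⟩ = y_j, as the coloring rule at a crossing of the
edge with the j-th virtual edge requires. These transitions (`VerticalTribracket.step`) are
permutations of X × X^c.

Two steps commute (`step_comm`). Center-involutivity makes the resulting color symmetric in the two
strands (`shift_eq_shift`), and the second exchange identity says that a third virtual strand may
pass a crossing on either side (`shift_shift`). Hence going around a crossing changes nothing. Since
the plane is simply connected, such a flat system has exactly one section with a prescribed value in
a given region (`exists_isSection`, `IsSection.eq`).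

The first coordinate of a section is a coloring. Conversely, in a coloring each virtual color can be
transported over the whole plane, normalized to agree with the real color across one edge of its
component. This agreement survives crossings and vertices, hence holds along the entire component
(`holdsAlong_component`), so the coloring lifts to a section. The lift is unique (`eq_of_fst_eq`).
Colorings therefore correspond to elements of X × X^c, whatever the diagram. Under the involution
the rules for positive and negative crossings coincide, so crossing signs play no role. -/

open Set Topology Filter

/-! ### Planar topology: connectedness and patching of local sections -/

/-- A convex open subset of a real vector space of dimension `> 1` stays preconnected when a
countable set is removed. -/
theorem Convex.isPreconnected_diff_countable {E : Type*} [NormedAddCommGroup E] [NormedSpace ℝ E]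
    (h : 1 < Module.rank ℝ E) {V Z : Set E} (hV : Convex ℝ V) (hVo : IsOpen V)
    (hs : Z.Countable) : IsPreconnected (V \ Z) := by
  refine isPreconnected_of_forall_pair fun a ha b hb => ?_
  suffices H : JoinedIn (V \ Z) a b by
    obtain ⟨γ, hγ⟩ := H
    exact ⟨range γ, range_subset_iff.2 hγ, ⟨0, by simp⟩, ⟨1, by simp⟩,
      isPreconnected_range γ.continuous⟩
  rcases eq_or_ne a b with rfl | hab
  · exact JoinedIn.refl ha
  let c := (2 : ℝ)⁻¹ • (a + b)
  let x := (2 : ℝ)⁻¹ • (b - a)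
  have Ia : c - x = a := by simp only [c, x]; module
  have Ib : c + x = b := by simp only [c, x]; module
  have x_ne_zero : x ≠ 0 := by simpa [x] using sub_ne_zero.2 hab.symm
  obtain ⟨y, hy⟩ : ∃ y, LinearIndependent ℝ ![x, y] :=
    exists_linearIndependent_pair_of_one_lt_rank h x_ne_zero
  -- Join `a` to `b` by broken lines through `c + t • y`. For different `t` the segments at one end
  -- share only that end, so only countably many `t` meet `Z`.
  have A : Set.Countable {t : ℝ | (segment ℝ (c + x) (c + t • y) ∩ Z).Nonempty} := by
    apply countable_ofPred_nonempty_of_disjoint _ (fun t ↦ inter_subset_right) hs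
    intro t t' htt'
    apply disjoint_iff_inter_eq_empty.2
    have N : {c + x} ∩ Z = ∅ := by
      simpa only [singleton_inter_eq_empty, mem_compl_iff, Ib] using hb.2
    rw [inter_assoc, inter_comm Z, inter_assoc, inter_self, ← inter_assoc, ← subset_empty_iff, ← N]
    apply inter_subset_inter_left
    apply Eq.subset
    apply segment_inter_eq_endpoint_of_linearIndependent_of_ne hy htt'.symm
  have B : Set.Countable {t : ℝ | (segment ℝ (c - x) (c + t • y) ∩ Z).Nonempty} := by
    apply countable_ofPred_nonempty_of_disjoint _ (fun t ↦ inter_subset_right) hs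
    intro t t' htt'
    apply disjoint_iff_inter_eq_empty.2
    have N : {c - x} ∩ Z = ∅ := by
      simpa only [singleton_inter_eq_empty, mem_compl_iff, Ia] using ha.2
    rw [inter_assoc, inter_comm Z, inter_assoc, inter_self, ← inter_assoc, ← subset_empty_iff, ← N]
    apply inter_subset_inter_left
    rw [sub_eq_add_neg _ x]
    apply Eq.subset
    apply segment_inter_eq_endpoint_of_linearIndependent_of_ne _ htt'.symm
    convert! hy.units_smul ![-1, 1]
    simp [← List.ofFn_inj]
  have hc : c ∈ V := by
    have := hV ha.1 hb.1 (a := 2⁻¹) (b := 2⁻¹) (by norm_num) (by norm_num) (by norm_num)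
    simpa only [c, smul_add] using this
  have hO : IsOpen {t : ℝ | c + t • y ∈ V} := hVo.preimage (by fun_prop)
  obtain ⟨t, htV, ht⟩ := ((A.union B).dense_compl ℝ).inter_open_nonempty _ hO ⟨0, by simpa using hc⟩
  simp only [compl_union, mem_inter_iff, mem_compl_iff, mem_ofPred_eq, not_nonempty_iff_eq_empty]
    at ht
  have J : ∀ w ∈ V, segment ℝ w (c + t • y) ∩ Z = ∅ → JoinedIn (V \ Z) w (c + t • y) :=
    fun w hw hwZ => JoinedIn.of_segment_subset fun v hv =>
      ⟨hV.segment_subset hw htV hv, fun hvZ => by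
        have : v ∈ segment ℝ w (c + t • y) ∩ Z := ⟨hv, hvZ⟩
        rw [hwZ] at this; exact this⟩
  have JA := J a ha.1 (by rw [← Ia]; exact ht.2)
  have JB := J b hb.1 (by rw [← Ib]; exact ht.1)
  exact JA.trans JB.symm

/-- A hereditary property of bounded open intervals that passes to unions of overlapping intervals
and holds near every point holds for all of them. -/
theorem interval_induction (P : ℝ → ℝ → Prop)
    (mono : ∀ a b a' b', a ≤ a' → b' ≤ b → P a b → P a' b')
    (glue : ∀ a b a' b', a ≤ a' → a' < b → b ≤ b' → P a b → P a' b' → P a b')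
    (loc : ∀ x, ∃ ε > 0, P (x - ε) (x + ε)) (a b : ℝ) (hab : a < b) : P a b := by
  -- The slack `ε` makes points of `S` interior and leaves the overlap that `glue` needs; a
  -- connectedness argument on `[a, b]` then applies.
  let S : Set ℝ := {x | ∃ ε > 0, P a (x + ε)}
  have ha : a ∈ S := by
    obtain ⟨ε, h0, h⟩ := loc a
    exact ⟨ε, h0, mono _ _ _ _ (by linarith) le_rfl h⟩
  have hS : Icc a b ⊆ S := by
    have key : ∀ x, a ≤ x → ∀ ε > 0, P (x - ε) (x + ε) → ∀ y ∈ S, x - ε < y → P a (x + ε) := by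
      rintro x hx ε h0 hP y ⟨δ, hδ, hy⟩ hxy
      rcases le_or_gt (x - ε) a with h1 | h1
      · exact mono _ _ _ _ h1 le_rfl hP
      · rcases le_or_gt (x + ε) (y + δ) with h2 | h2
        · exact mono _ _ _ _ le_rfl h2 hy
        · exact glue _ (y + δ) (x - ε) _ h1.le (by linarith) h2.le hy hP
    have hpre : IsPreconnected (Icc a b) := isPreconnected_Icc
    refine hpre.subset_of_closure_inter_subset (u := interior S) ?_ ?_ ?_ |>.trans interior_subset
    · exact isOpen_interior
    · refine ⟨a, left_mem_Icc.2 hab.le, ?_⟩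
      obtain ⟨ε, h0, h⟩ := ha
      rw [mem_interior_iff_mem_nhds]
      filter_upwards [Iio_mem_nhds (show a < a + ε by linarith)] with y hy
      exact ⟨a + ε - y, by have := mem_Iio.1 hy; linarith, by ring_nf; ring_nf at h; exact h⟩
    · rintro x ⟨hx, hxI⟩
      obtain ⟨ε, h0, h⟩ := loc x
      obtain ⟨y, hy1, hy2⟩ := mem_closure_iff_nhds.1 hx (Ioi (x - ε)) (Ioi_mem_nhds (by linarith))
      have := key x hxI.1 ε h0 h y (interior_subset hy2) hy1
      rw [mem_interior_iff_mem_nhds]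
      filter_upwards [Iio_mem_nhds (show x < x + ε by linarith)] with y hy
      exact ⟨x + ε - y, by have := mem_Iio.1 hy; linarith, by ring_nf; ring_nf at this; exact this⟩
  obtain ⟨ε, h0, h⟩ := hS (right_mem_Icc.2 hab.le)
  exact mono _ _ _ _ le_rfl (by linarith) h

/-- Local sections of a system on the plane that exist around each point with every prescribed
value, and that are determined on boxes by one value, extend to global sections. `U` is the set
where values are meaningful. -/
theorem exists_global_section {S : Type*} (U : Set (ℝ × ℝ)) (hU : Dense U)
    (Sec : (ℝ × ℝ → S) → ℝ × ℝ → Prop)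
    (congr : ∀ G G' p, (∀ᶠ a in 𝓝 p, a ∈ U → G a = G' a) → Sec G p → Sec G' p)
    (ex : ∀ p, ∃ V, IsOpen V ∧ p ∈ V ∧ ∀ q ∈ V ∩ U, ∀ s, ∃ G, (∀ p' ∈ V, Sec G p') ∧ G q = s)
    (uniq : ∀ V, IsOpen V → Convex ℝ V → ∀ G G', (∀ p ∈ V, Sec G p) → (∀ p ∈ V, Sec G' p) →
      ∀ q ∈ V ∩ U, G q = G' q → ∀ a ∈ V ∩ U, G a = G' a)
    (q : ℝ × ℝ) (hq : q ∈ U) (s : S) : ∃ G, (∀ p, Sec G p) ∧ G q = s := by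
  classical
  let Good : Set (ℝ × ℝ) → Prop := fun V =>
    ∀ q ∈ V ∩ U, ∀ s, ∃ G, (∀ p' ∈ V, Sec G p') ∧ G q = s
  have mono : ∀ V V', V' ⊆ V → Good V → Good V' := fun V V' hV h q hq s => by
    obtain ⟨G, h1, h2⟩ := h q ⟨hV hq.1, hq.2⟩ s
    exact ⟨G, fun p hp => h1 p (hV hp), h2⟩
  have glue : ∀ V₁ V₂, IsOpen V₁ → IsOpen V₂ → Convex ℝ V₁ → Convex ℝ V₂ → (V₁ ∩ V₂).Nonempty →
      Good V₁ → Good V₂ → Good (V₁ ∪ V₂) := by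
    have aux : ∀ V₁ V₂, IsOpen V₁ → IsOpen V₂ → Convex ℝ V₁ → Convex ℝ V₂ → (V₁ ∩ V₂).Nonempty →
        Good V₁ → Good V₂ → ∀ q ∈ V₁ ∩ U, ∀ s, ∃ G, (∀ p' ∈ V₁ ∪ V₂, Sec G p') ∧ G q = s := by
      intro V₁ V₂ o1 o2 c1 c2 hne g1 g2 q hq s
      obtain ⟨G₁, h1, rfl⟩ := g1 q hq s
      -- Match the two sections at one point `m` of the overlap. The overlap is convex, so `uniq`
      -- makes them agree on all of it and they can be pasted.
      obtain ⟨m, hm, hmU⟩ := hU.inter_open_nonempty _ (o1.inter o2) hne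
      obtain ⟨G₂, h2, e2⟩ := g2 m ⟨hm.2, hmU⟩ (G₁ m)
      have hag := uniq _ (o1.inter o2) (c1.inter c2) G₁ G₂ (fun p hp => h1 p hp.1)
        (fun p hp => h2 p hp.2) m ⟨hm, hmU⟩ e2.symm
      refine ⟨V₁.piecewise G₁ G₂, ?_, by simp [hq.1]⟩
      rintro p (hp | hp)
      · refine congr G₁ _ p ?_ (h1 p hp)
        filter_upwards [o1.mem_nhds hp] with a ha _
        simp [ha]
      · refine congr G₂ _ p ?_ (h2 p hp)
        filter_upwards [o2.mem_nhds hp] with a ha haU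
        by_cases h : a ∈ V₁
        · simpa [h] using (hag a ⟨⟨h, ha⟩, haU⟩).symm
        · simp [h]
    intro V₁ V₂ o1 o2 c1 c2 hne g1 g2 q hq s
    rcases hq with ⟨hq | hq, hqU⟩
    · exact aux V₁ V₂ o1 o2 c1 c2 hne g1 g2 q ⟨hq, hqU⟩ s
    · rw [union_comm]
      exact aux V₂ V₁ o2 o1 c2 c1 (by rwa [inter_comm]) g2 g1 q ⟨hq, hqU⟩ s
  let Bx : ℝ → ℝ → ℝ → ℝ → Set (ℝ × ℝ) := fun a b c d => Ioo a b ×ˢ Ioo c d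
  have Bo : ∀ a b c d, IsOpen (Bx a b c d) := fun a b c d => isOpen_Ioo.prod isOpen_Ioo
  have Bc : ∀ a b c d, Convex ℝ (Bx a b c d) := fun a b c d =>
    (convex_Ioo a b).prod (convex_Ioo c d)
  have Bm : ∀ {a b c d a' b' c' d'}, a ≤ a' → b' ≤ b → c ≤ c' → d' ≤ d →
      Bx a' b' c' d' ⊆ Bx a b c d := fun h1 h2 h3 h4 =>
    prod_mono (Ioo_subset_Ioo h1 h2) (Ioo_subset_Ioo h3 h4)
  -- Boxes grow first vertically, with a width that may shrink at each gluing, then horizontally at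
  -- fixed height.
  have col : ∀ x c d, c < d → ∃ ε > 0, Good (Bx (x - ε) (x + ε) c d) := by
    intro x c d hcd
    refine interval_induction (fun c d => ∃ ε > 0, Good (Bx (x - ε) (x + ε) c d)) ?_ ?_ ?_ c d hcd
    · rintro c d c' d' h1 h2 ⟨ε, h0, h⟩
      exact ⟨ε, h0, mono _ _ (Bm le_rfl le_rfl h1 h2) h⟩
    · rintro c d c' d' h1 h2 h3 ⟨ε, h0, h⟩ ⟨ε', h0', h'⟩
      have hm : 0 < min ε ε' := lt_min h0 h0'
      refine ⟨min ε ε', hm, mono _ _ ?_ (glue _ _ (Bo _ _ _ _) (Bo _ _ _ _) (Bc _ _ _ _)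
        (Bc _ _ _ _) ?_ (mono _ (Bx (x - min ε ε') (x + min ε ε') c d) ?_ h)
        (mono _ (Bx (x - min ε ε') (x + min ε ε') c' d') ?_ h'))⟩
      · rintro ⟨u, v⟩ ⟨hu, hv⟩
        rcases lt_or_ge v d with hd | hd
        · exact Or.inl ⟨hu, hv.1, hd⟩
        · exact Or.inr ⟨hu, lt_of_lt_of_le h2 hd, hv.2⟩
      · refine ⟨(x, (c' + d) / 2), ⟨⟨by simp [hm], by simp [hm]⟩, ?_⟩,
          ⟨by simp [hm], by simp [hm]⟩, ?_⟩ <;> constructor <;> simp only <;> linarith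
      · have := min_le_left ε ε'
        exact Bm (by linarith) (by linarith) le_rfl le_rfl
      · have := min_le_right ε ε'
        exact Bm (by linarith) (by linarith) le_rfl le_rfl
    · intro y
      obtain ⟨V, o, hp, h⟩ := ex (x, y)
      obtain ⟨ε, h0, hε⟩ := Metric.isOpen_iff.1 o _ hp
      refine ⟨ε, h0, ε, h0, mono V _ ?_ h⟩
      rw [← ball_prod_same, Real.ball_eq_Ioo, Real.ball_eq_Ioo] at hε
      exact hε
  have box : ∀ a b c d, a < b → c < d → Good (Bx a b c d) := by
    intro a b c d hab hcd
    refine interval_induction (fun a b => Good (Bx a b c d)) ?_ ?_ (fun x => col x c d hcd) a b hab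
    · intro a b a' b' h1 h2 h
      exact mono _ _ (Bm h1 h2 le_rfl le_rfl) h
    · intro a b a' b' h1 h2 h3 h h'
      refine mono _ _ ?_ (glue _ _ (Bo _ _ _ _) (Bo _ _ _ _) (Bc _ _ _ _) (Bc _ _ _ _) ?_ h h')
      · rintro ⟨u, v⟩ ⟨hu, hv⟩
        rcases lt_or_ge u b with hd | hd
        · exact Or.inl ⟨⟨hu.1, hd⟩, hv⟩
        · exact Or.inr ⟨⟨lt_of_lt_of_le h2 hd, hu.2⟩, hv⟩
      · refine ⟨((a' + b) / 2, (c + d) / 2), ⟨?_, ?_⟩, ?_, ?_⟩ <;> constructor <;> simp only <;>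
          linarith
  let W : ℝ → Set (ℝ × ℝ) := fun n => Bx (-n) n (-n) n
  have Wm : ∀ {m n}, m ≤ n → W m ⊆ W n := fun h => Bm (by linarith) h (by linarith) h
  have Wmem : ∀ a n, ‖a‖ < n → a ∈ W n := fun a n h => by
    have h1 := (norm_fst_le a).trans_lt h
    have h2 := (norm_snd_le a).trans_lt h
    rw [Real.norm_eq_abs, abs_lt] at h1 h2
    exact ⟨h1, h2⟩
  have hn : ∀ n, ∃ G, ‖q‖ < n → (∀ p ∈ W n, Sec G p) ∧ G q = s := by
    intro n
    by_cases h : ‖q‖ < n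
    · have : 0 < n := (norm_nonneg q).trans_lt h
      obtain ⟨G, hG⟩ := box (-n) n (-n) n (by linarith) (by linarith) q ⟨Wmem q n h, hq⟩ s
      exact ⟨G, fun _ => hG⟩
    · exact ⟨fun _ => s, fun h' => absurd h' h⟩
  choose G hG using hn
  have N : ∀ a : ℝ × ℝ, ‖q‖ < ‖a‖ + ‖q‖ + 1 := fun a => by linarith [norm_nonneg a]
  -- The index is large enough for the square to contain both `a` and the base point `q`. Sections
  -- on two squares agree on the smaller one because both take the value `s` at `q`.
  refine ⟨fun a => G (‖a‖ + ‖q‖ + 1) a, fun p => ?_, (hG _ (N q)).2⟩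
  have hp1 : ‖p‖ < ‖p‖ + ‖q‖ + 1 := by linarith [norm_nonneg q]
  refine congr (G (‖p‖ + ‖q‖ + 1)) _ p ?_ ((hG _ (N p)).1 p (Wmem _ _ hp1))
  filter_upwards [(Bo _ _ _ _).mem_nhds (Wmem _ _ hp1)] with a ha haU
  have ha1 : ‖a‖ < ‖a‖ + ‖q‖ + 1 := by linarith [norm_nonneg q]
  have hqm : ‖q‖ < min (‖a‖ + ‖q‖ + 1) (‖p‖ + ‖q‖ + 1) := lt_min (N a) (N p)
  refine uniq (W (min (‖a‖ + ‖q‖ + 1) (‖p‖ + ‖q‖ + 1))) (Bo _ _ _ _) (Bc _ _ _ _) _ _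
    (fun x hx => (hG _ (N p)).1 x (Wm (min_le_right _ _) hx))
    (fun x hx => (hG _ (N a)).1 x (Wm (min_le_left _ _) hx)) q ⟨Wmem _ _ hqm, hq⟩
    ((hG _ (N p)).2.trans (hG _ (N a)).2.symm) a ⟨?_, haU⟩
  rcases le_total (‖a‖ + ‖q‖ + 1) (‖p‖ + ‖q‖ + 1) with h | h
  · rw [min_eq_left h]; exact Wmem _ _ ha1
  · rw [min_eq_right h]; exact ha

/-! ### Regions and edges -/

namespace OrientedPolygons

variable (P : OrientedPolygons)

instance : Finite P.Edge := P.finite_edge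

/-- The point `a` lies in the region `R`. -/
def InRegion (a : ℝ × ℝ) (R : P.Region) : Prop :=
  ∃ h : a ∈ P.complement, ConnectedComponents.mk (⟨a, h⟩ : P.complement) = R

/-- The point `p` lies on the edge `i` and on no other edge. -/
def SimpleOn (i : P.Edge) (p : ℝ × ℝ) : Prop :=
  p ∈ P.side i ∧ ∀ j, j ≠ i → p ∉ P.side j

/-- `p` lies on the edge `i` only, and there `R'` is the region to the left and `R` the region
to the right. -/
def Sides (i : P.Edge) (p : ℝ × ℝ) (R' R : P.Region) : Prop :=
  P.SimpleOn i p ∧ ∀ᶠ a in 𝓝 p, (0 < cross2 (P.dir i) (a - p) → P.InRegion a R') ∧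
    (cross2 (P.dir i) (a - p) < 0 → P.InRegion a R)

variable {P}

theorem InRegion.unique {a : ℝ × ℝ} {R R' : P.Region} (h : P.InRegion a R)
    (h' : P.InRegion a R') : R = R' := by
  obtain ⟨_, rfl⟩ := h
  obtain ⟨_, rfl⟩ := h'
  rfl

theorem exists_inRegion {a : ℝ × ℝ} (h : a ∈ P.complement) : ∃ R, P.InRegion a R := ⟨_, h, rfl⟩

theorem exists_mem_region (R : P.Region) : ∃ a, P.InRegion a R := by
  obtain ⟨⟨a, h⟩, rfl⟩ := ConnectedComponents.surjective_coe R
  exact ⟨a, h, rfl⟩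

theorem inRegion_of_isPreconnected {s : Set (ℝ × ℝ)} (hs : IsPreconnected s)
    (hsU : s ⊆ P.complement) {a b : ℝ × ℝ} (ha : a ∈ s) (hb : b ∈ s) {R : P.Region}
    (h : P.InRegion a R) : P.InRegion b R := by
  obtain ⟨h, rfl⟩ := h
  refine ⟨hsU hb, ?_⟩
  rw [ConnectedComponents.coe_eq_coe']
  have : IsPreconnected ((↑) ⁻¹' s : Set P.complement) := by
    rw [← Topology.IsInducing.subtypeVal.isPreconnected_image, Subtype.image_preimage_coe,
      inter_eq_right.2 hsU]
    exact hs
  have hb' : (⟨b, hsU hb⟩ : P.complement) ∈ ((↑) ⁻¹' s : Set P.complement) := hb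
  exact this.subset_connectedComponent (show (⟨a, h⟩ : P.complement) ∈ _ from ha) hb'

theorem exists_region {s : Set (ℝ × ℝ)} (hs : IsPreconnected s)
    (hsU : s ⊆ P.complement) (hne : s.Nonempty) : ∃ R, ∀ a ∈ s, P.InRegion a R := by
  obtain ⟨b, hb⟩ := hne
  obtain ⟨R, hR⟩ := exists_inRegion (hsU hb)
  exact ⟨R, fun a ha => inRegion_of_isPreconnected hs hsU hb ha hR⟩

theorem isClosed_side (i : P.Edge) : IsClosed (P.side i) := by
  rw [side, segment_eq_image]
  exact (isCompact_Icc.image (by fun_prop)).isClosed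

theorem isOpen_complement : IsOpen P.complement :=
  (isClosed_iUnion_of_finite fun i => isClosed_side i).isOpen_compl

theorem mem_complement {a : ℝ × ℝ} : a ∈ P.complement ↔ ∀ i, a ∉ P.side i := by
  simp [complement]

theorem InRegion.eventually {a : ℝ × ℝ} {R : P.Region} (h : P.InRegion a R) :
    ∀ᶠ b in 𝓝 a, P.InRegion b R := by
  obtain ⟨ε, h0, hε⟩ := Metric.isOpen_iff.1 P.isOpen_complement a h.1
  filter_upwards [Metric.ball_mem_nhds a h0] with b hb
  exact inRegion_of_isPreconnected Metric.isPreconnected_ball hε (Metric.mem_ball_self h0) hb h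

/-- There are finitely many edges and each is closed, so those avoiding `p` avoid a neighbourhood of
it. -/
theorem eventually_mem_side (p : ℝ × ℝ) : ∀ᶠ a in 𝓝 p, ∀ k, a ∈ P.side k → p ∈ P.side k := by
  rw [eventually_all]
  intro k
  by_cases h : p ∈ P.side k
  · exact Eventually.of_forall fun _ _ => h
  · filter_upwards [(isClosed_side k).isOpen_compl.mem_nhds h] with a ha ha'
    exact absurd ha' ha

theorem mem_side {i : P.Edge} {a : ℝ × ℝ} :
    a ∈ P.side i ↔ ∃ t : ℝ, 0 ≤ t ∧ t ≤ 1 ∧ a = P.pt i + t • P.dir i := by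
  rw [side, segment_eq_image']
  constructor
  · rintro ⟨t, ⟨h0, h1⟩, rfl⟩
    exact ⟨t, h0, h1, rfl⟩
  · rintro ⟨t, h0, h1, rfl⟩
    exact ⟨t, ⟨h0, h1⟩, rfl⟩

theorem pt_next (i : P.Edge) : P.pt (P.next i) = P.pt i + P.dir i := by simp [dir]

theorem start_mem_side (i : P.Edge) : P.pt i ∈ P.side i := left_mem_segment ℝ _ _

theorem end_mem_side (i : P.Edge) : P.pt (P.next i) ∈ P.side i := right_mem_segment ℝ _ _

end OrientedPolygons

/-! ### The cross product and its half-planes -/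

theorem cross2_smul (d w : ℝ × ℝ) (s : ℝ) : cross2 d (s • w) = s * cross2 d w := by
  simp [cross2]; ring

theorem cross2_swap (d w : ℝ × ℝ) : cross2 w d = - cross2 d w := by simp [cross2]; ring

@[simp] theorem cross2_self (d : ℝ × ℝ) : cross2 d d = 0 := by simp [cross2]; ring

theorem cross2_sub (d v w : ℝ × ℝ) : cross2 d (v - w) = cross2 d v - cross2 d w := by
  simp [cross2]; ring

theorem cross2_add (d v w : ℝ × ℝ) : cross2 d (v + w) = cross2 d v + cross2 d w := by
  simp [cross2]; ring

theorem cross2_neg (d v : ℝ × ℝ) : cross2 d (-v) = -cross2 d v := by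
  simp [cross2]; ring

theorem cross2_neg_left (d v : ℝ × ℝ) : cross2 (-d) v = -cross2 d v := by
  simp [cross2]; ring

theorem continuous_cross2 (d p : ℝ × ℝ) : Continuous fun a => cross2 d (a - p) := by
  unfold cross2; fun_prop

theorem exists_smul_of_cross2_eq_zero {d v : ℝ × ℝ} (hd : d ≠ 0) (h : cross2 d v = 0) :
    ∃ s : ℝ, v = s • d := by
  obtain ⟨d1, d2⟩ := d
  obtain ⟨v1, v2⟩ := v
  simp only [cross2] at h
  by_cases h1 : d1 = 0
  · have h2 : d2 ≠ 0 := fun h2 => hd (by rw [h1, h2]; rfl)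
    subst h1
    have : v1 = 0 := by
      have : d2 * v1 = 0 := by linarith
      exact (mul_eq_zero.1 this).resolve_left h2
    exact ⟨v2 / d2, by ext <;> simp [this, h2]⟩
  · refine ⟨v1 / d1, ?_⟩
    ext
    · simp [h1]
    · simp only [Prod.smul_mk, smul_eq_mul]
      field_simp
      linarith

theorem convex_cross2_pos (d p : ℝ × ℝ) : Convex ℝ {a | 0 < cross2 d (a - p)} := by
  have : {a | 0 < cross2 d (a - p)} = {a | cross2 d p < cross2 d a} := by
    ext a; simp [cross2_sub]
  rw [this]
  exact convex_halfSpace_gt ⟨fun x y => by simp [cross2]; ring, fun c x => cross2_smul d x c⟩ _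

theorem convex_cross2_neg (d p : ℝ × ℝ) : Convex ℝ {a | cross2 d (a - p) < 0} := by
  have := convex_cross2_pos (-d) p
  simpa [cross2_neg_left] using this

theorem eventually_small_smul (p d : ℝ × ℝ) (hd : d ≠ 0) {δ : ℝ} (hδ : 0 < δ) :
    ∀ᶠ a in 𝓝 p, ∀ s : ℝ, a = p + s • d → |s| < δ := by
  have hd' : 0 < ‖d‖ := norm_pos_iff.2 hd
  filter_upwards [Metric.ball_mem_nhds p (mul_pos hδ hd')] with a ha s hs
  rw [hs, Metric.mem_ball, dist_eq_norm, add_sub_cancel_left, norm_smul, Real.norm_eq_abs] at ha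
  exact lt_of_mul_lt_mul_right ha hd'.le

theorem eventually_add_smul {p : ℝ × ℝ} (w : ℝ × ℝ) {Q : ℝ × ℝ → Prop} (h : ∀ᶠ a in 𝓝 p, Q a) :
    ∀ᶠ s : ℝ in 𝓝[>] 0, Q (p + s • w) := by
  have : Tendsto (fun s : ℝ => p + s • w) (𝓝[>] 0) (𝓝 p) := by
    have : Continuous fun s : ℝ => p + s • w := by fun_prop
    simpa using (this.tendsto 0).mono_left nhdsWithin_le_nhds
  exact this.eventually h

theorem exists_add_smul {p : ℝ × ℝ} (w : ℝ × ℝ) {Q : ℝ × ℝ → Prop} (h : ∀ᶠ a in 𝓝 p, Q a) :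
    ∃ s : ℝ, 0 < s ∧ Q (p + s • w) :=
  ((eventually_mem_nhdsWithin (a := (0 : ℝ)) (s := Ioi 0)).and (eventually_add_smul w h)).exists

/-! ### Consequences of general position -/

namespace LinkDiagram

open OrientedPolygons

variable {D : LinkDiagram}

theorem dir_ne_zero (i : D.Edge) : D.dir i ≠ 0 := fun h =>
  D.next_ne i (D.pt_injective (sub_eq_zero.1 h))

/-- The endpoints of an edge also lie on the preceding or following edge. -/
theorem exists_interior_of_simpleOn {i : D.Edge} {p : ℝ × ℝ} (h : D.SimpleOn i p) :
    ∃ t : ℝ, 0 < t ∧ t < 1 ∧ p = D.pt i + t • D.dir i := by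
  obtain ⟨t, h0, h1, e⟩ := mem_side.1 h.1
  refine ⟨t, h0.lt_of_ne ?_, h1.lt_of_ne ?_, e⟩
  · rintro rfl
    refine h.2 (D.next.symm i) (fun h' => ?_) ?_
    · exact D.next_ne _ ((congrArg D.next h').symm.trans (by simp)).symm.symm
    · have := D.end_mem_side (D.next.symm i)
      simpa [e] using this
  · rintro rfl
    refine h.2 (D.next i) (D.next_ne i) ?_
    rw [e, one_smul, ← pt_next]
    exact start_mem_side _

theorem exists_interior_of_crosses {i j : D.Edge} (h : D.Crosses i j) {p : ℝ × ℝ}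
    (hi : p ∈ D.side i) (hj : p ∈ D.side j) :
    ∃ t : ℝ, 0 < t ∧ t < 1 ∧ p = D.pt i + t • D.dir i := by
  obtain ⟨t, h0, h1, e⟩ := mem_side.1 hi
  obtain ⟨n1, n2, n3, -⟩ := h
  refine ⟨t, h0.lt_of_ne ?_, h1.lt_of_ne ?_, e⟩
  · rintro rfl
    rw [zero_smul, add_zero] at e
    rcases D.pt_mem_side j i (e ▸ hj) with h | h
    · exact n1 h
    · exact n3 h.symm
  · rintro rfl
    rw [one_smul, ← pt_next] at e
    rcases D.pt_mem_side j _ (e ▸ hj) with h | h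
    · exact n2 h
    · exact n1 (D.next.injective h)

theorem crosses_symm {i j : D.Edge} (h : D.Crosses i j) : D.Crosses j i :=
  ⟨h.1.symm, h.2.2.1, h.2.1, by rw [inter_comm]; exact h.2.2.2⟩

theorem cross2_eq_zero_of_mem_side {i : D.Edge} {a p : ℝ × ℝ} (ha : a ∈ D.side i)
    (hp : p ∈ D.side i) : cross2 (D.dir i) (a - p) = 0 := by
  obtain ⟨s, -, -, rfl⟩ := mem_side.1 ha
  obtain ⟨t, -, -, rfl⟩ := mem_side.1 hp
  simp [cross2]; ring

theorem exists_smul_of_cross2 {i : D.Edge} {a p : ℝ × ℝ} (h : cross2 (D.dir i) (a - p) = 0) :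
    ∃ s : ℝ, a = p + s • D.dir i := by
  obtain ⟨s, hs⟩ := exists_smul_of_cross2_eq_zero (dir_ne_zero i) h
  exact ⟨s, by rw [← hs]; abel⟩

theorem eventually_mem_side_interior {i : D.Edge} {p : ℝ × ℝ}
    (h : ∃ t : ℝ, 0 < t ∧ t < 1 ∧ p = D.pt i + t • D.dir i) :
    ∀ᶠ a in 𝓝 p, (a ∈ D.side i ↔ cross2 (D.dir i) (a - p) = 0) := by
  obtain ⟨t, h0, h1, rfl⟩ := h
  filter_upwards [eventually_small_smul _ (D.dir i) (dir_ne_zero i) (lt_min h0 (sub_pos.2 h1))]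
    with a ha
  refine ⟨fun h => cross2_eq_zero_of_mem_side h (mem_side.2 ⟨t, h0.le, h1.le, rfl⟩), fun h => ?_⟩
  obtain ⟨s, rfl⟩ := exists_smul_of_cross2 h
  have hs := abs_lt.1 (ha s rfl)
  have := min_le_left t (1 - t)
  have := min_le_right t (1 - t)
  exact mem_side.2 ⟨t + s, by linarith, by linarith, by module⟩

theorem eventually_mem_side_start (i : D.Edge) :
    ∀ᶠ a in 𝓝 (D.pt i), (a ∈ D.side i ↔ ∃ s : ℝ, 0 ≤ s ∧ a = D.pt i + s • D.dir i) := by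
  filter_upwards [eventually_small_smul _ (D.dir i) (dir_ne_zero i) one_pos] with a ha
  rw [mem_side]
  constructor
  · rintro ⟨s, h0, -, h⟩
    exact ⟨s, h0, h⟩
  · rintro ⟨s, h0, h⟩
    exact ⟨s, h0, (abs_lt.1 (ha s h)).2.le, h⟩

theorem eventually_mem_side_end (i : D.Edge) :
    ∀ᶠ a in 𝓝 (D.pt (D.next i)),
      (a ∈ D.side i ↔ ∃ s : ℝ, s ≤ 0 ∧ a = D.pt (D.next i) + s • D.dir i) := by
  filter_upwards [eventually_small_smul _ (D.dir i) (dir_ne_zero i) one_pos] with a ha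
  rw [mem_side]
  constructor
  · rintro ⟨s, -, h1, h⟩
    exact ⟨s - 1, by linarith, by rw [h, pt_next]; module⟩
  · rintro ⟨s, h0, h⟩
    have := (abs_lt.1 (ha s h)).1
    exact ⟨1 + s, by linarith, by linarith, by rw [h, pt_next]; module⟩

/-- Parallel edges meeting at a point interior to both would share a short segment, against
`side_inter_side`. -/
theorem cross2_ne_zero_of_crosses {i j : D.Edge} (h : D.Crosses i j) :
    cross2 (D.dir i) (D.dir j) ≠ 0 := by
  intro h0
  obtain ⟨p, hi, hj⟩ := h.2.2.2
  have e1 := eventually_mem_side_interior (exists_interior_of_crosses h hi hj)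
  have e2 := eventually_mem_side_interior (exists_interior_of_crosses (crosses_symm h) hj hi)
  obtain ⟨s, hs, h1, h2⟩ := exists_add_smul (D.dir i) (e1.and e2)
  have := D.side_inter_side i j h.1 ⟨h1.2 (by simp [cross2_smul]), h2.2 (by
    simp [cross2_smul, cross2_swap (D.dir i), h0])⟩ ⟨hi, hj⟩
  simp [hs.ne', dir_ne_zero] at this

/-- An edge that turned straight back would overlap its predecessor in more than the vertex. -/
theorem not_antiparallel {i : D.Edge} {c : ℝ} (h : D.dir (D.next i) = c • D.dir i) : 0 < c := by
  by_contra hc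
  have hc : c < 0 := by
    refine lt_of_le_of_ne (not_lt.1 hc) ?_
    rintro rfl
    exact dir_ne_zero _ (h.trans (zero_smul _ _))
  obtain ⟨s, hs, h1, h2⟩ := exists_add_smul (D.dir (D.next i))
    ((eventually_mem_side_end i).and (eventually_mem_side_start (D.next i)))
  have := D.side_inter_side i (D.next i) (D.next_ne i).symm
    ⟨h1.2 ⟨s * c, mul_nonpos_of_nonneg_of_nonpos hs.le hc.le, by rw [h, smul_smul]⟩,
      h2.2 ⟨s, hs.le, rfl⟩⟩ ⟨end_mem_side i, start_mem_side _⟩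
  simp [hs.ne', dir_ne_zero] at this

variable (D) in
/-- The points that lie on two edges: vertices and crossings. -/
def multiplePoints : Set (ℝ × ℝ) := {p | ∃ i j, i ≠ j ∧ p ∈ D.side i ∩ D.side j}

theorem finite_multiplePoints : D.multiplePoints.Finite := by
  have : D.multiplePoints ⊆ ⋃ ij : {ij : D.Edge × D.Edge // ij.1 ≠ ij.2},
      D.side ij.1.1 ∩ D.side ij.1.2 := by
    rintro p ⟨i, j, h, hp⟩
    exact mem_iUnion.2 ⟨⟨(i, j), h⟩, hp⟩
  exact (finite_iUnion fun ij => (D.side_inter_side _ _ ij.2).finite).subset this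

theorem simpleOn_of_notMem_multiplePoints {p : ℝ × ℝ} (h : p ∉ D.multiplePoints) {i : D.Edge}
    (hi : p ∈ D.side i) : D.SimpleOn i p :=
  ⟨hi, fun j hj hp => h ⟨j, i, hj, hp, hi⟩⟩

theorem SimpleOn.notMem_multiplePoints {i : D.Edge} {p : ℝ × ℝ} (h : D.SimpleOn i p) :
    p ∉ D.multiplePoints := by
  rintro ⟨k, l, hkl, hk, hl⟩
  have key : ∀ m, p ∈ D.side m → m = i := fun m hm => by_contra fun hne => h.2 m hne hm
  exact hkl ((key k hk).trans (key l hl).symm)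

theorem eq_vertex {i : D.Edge} {p : ℝ × ℝ} (h1 : p ∈ D.side i) (h2 : p ∈ D.side (D.next i)) :
    p = D.pt (D.next i) :=
  D.side_inter_side i _ (D.next_ne i).symm ⟨h1, h2⟩ ⟨end_mem_side i, start_mem_side _⟩

/-- A point of the plane is in a region, interior to one edge, a vertex, or a crossing. -/
theorem point_cases (p : ℝ × ℝ) : p ∈ D.complement ∨ (∃ i, D.SimpleOn i p) ∨
    (∃ i, p = D.pt (D.next i)) ∨ ∃ i j, D.Crosses i j ∧ p ∈ D.side i ∧ p ∈ D.side j ∧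
      0 < cross2 (D.dir i) (D.dir j) := by
  by_cases h : p ∈ D.multiplePoints
  · obtain ⟨i, j, hij, hi, hj⟩ := h
    right; right
    by_cases h1 : D.next i = j
    · subst h1
      exact Or.inl ⟨i, eq_vertex hi hj⟩
    by_cases h2 : D.next j = i
    · subst h2
      exact Or.inl ⟨j, eq_vertex hj hi⟩
    have hc : D.Crosses i j := ⟨hij, h1, h2, p, hi, hj⟩
    rcases (cross2_ne_zero_of_crosses hc).lt_or_gt with h | h
    · exact Or.inr ⟨j, i, crosses_symm hc, hj, hi, by rw [cross2_swap]; linarith⟩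
    · exact Or.inr ⟨i, j, hc, hi, hj, h⟩
  · by_cases hp : p ∈ D.complement
    · exact Or.inl hp
    · rw [mem_complement] at hp
      push Not at hp
      obtain ⟨i, hi⟩ := hp
      exact Or.inr (Or.inl ⟨i, simpleOn_of_notMem_multiplePoints h hi⟩)

end LinkDiagram

/-! ### Local pictures at crossings, edge points and vertices -/

namespace LinkDiagram

open OrientedPolygons

variable {D : LinkDiagram}

/-- The situation near a crossing `p` of `i` and `j`, where `j` points to the left of `i`: the
regions to the left of both, behind, to the right of both, and in front. -/
structure CrossingChart (i j : D.Edge) (p : ℝ × ℝ) (l b r f : D.Region) : Prop where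
  crosses : D.Crosses i j
  mem_left : p ∈ D.side i
  mem_right : p ∈ D.side j
  pos : 0 < cross2 (D.dir i) (D.dir j)
  regions : ∀ᶠ a in 𝓝 p,
    (0 < cross2 (D.dir i) (a - p) → 0 < cross2 (D.dir j) (a - p) → D.InRegion a l) ∧
    (cross2 (D.dir i) (a - p) < 0 → 0 < cross2 (D.dir j) (a - p) → D.InRegion a b) ∧
    (cross2 (D.dir i) (a - p) < 0 → cross2 (D.dir j) (a - p) < 0 → D.InRegion a r) ∧
    (0 < cross2 (D.dir i) (a - p) → cross2 (D.dir j) (a - p) < 0 → D.InRegion a f)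
  mem_side : ∀ᶠ a in 𝓝 p, (a ∈ D.side i ↔ cross2 (D.dir i) (a - p) = 0) ∧
    (a ∈ D.side j ↔ cross2 (D.dir j) (a - p) = 0) ∧ ∀ k, a ∈ D.side k → k = i ∨ k = j
  sides : ∀ᶠ a in 𝓝 p,
    (cross2 (D.dir i) (a - p) = 0 → 0 < cross2 (D.dir j) (a - p) → D.Sides i a l b) ∧
    (cross2 (D.dir i) (a - p) = 0 → cross2 (D.dir j) (a - p) < 0 → D.Sides i a f r) ∧
    (cross2 (D.dir j) (a - p) = 0 → 0 < cross2 (D.dir i) (a - p) → D.Sides j a l f) ∧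
    (cross2 (D.dir j) (a - p) = 0 → cross2 (D.dir i) (a - p) < 0 → D.Sides j a b r)

/-- In a small ball only the two crossing edges are visible. They cut it into four sectors, each an
intersection of the ball with two half-planes, hence convex and inside a single region. -/
theorem exists_crossingChart {i j : D.Edge} {p : ℝ × ℝ} (hc : D.Crosses i j)
    (hi : p ∈ D.side i) (hj : p ∈ D.side j) (hpos : 0 < cross2 (D.dir i) (D.dir j)) :
    ∃ l b r f, CrossingChart i j p l b r f := by
  have hji : cross2 (D.dir j) (D.dir i) < 0 := by rw [cross2_swap]; linarith
  have E : ∀ᶠ a in 𝓝 p, (a ∈ D.side i ↔ cross2 (D.dir i) (a - p) = 0) ∧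
      (a ∈ D.side j ↔ cross2 (D.dir j) (a - p) = 0) ∧ ∀ k, a ∈ D.side k → k = i ∨ k = j := by
    filter_upwards [eventually_mem_side_interior (exists_interior_of_crosses hc hi hj),
      eventually_mem_side_interior (exists_interior_of_crosses (crosses_symm hc) hj hi),
      eventually_mem_side (P := D.toOrientedPolygons) p] with a h1 h2 h3
    refine ⟨h1, h2, fun k hk => ?_⟩
    by_contra! hne
    have := D.no_triple_point i j k hc.1 hne.2.symm hne.1.symm
    exact (this ▸ (⟨⟨hi, hj⟩, h3 k hk⟩ : p ∈ D.side i ∩ D.side j ∩ D.side k) : p ∈ (∅ : Set _))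
  obtain ⟨ε, h0, hε⟩ := Metric.eventually_nhds_iff_ball.1 E
  have compl : ∀ a ∈ Metric.ball p ε, cross2 (D.dir i) (a - p) ≠ 0 →
      cross2 (D.dir j) (a - p) ≠ 0 → a ∈ D.complement := by
    intro a ha h1 h2
    obtain ⟨e1, e2, e3⟩ := hε a ha
    refine mem_complement.2 fun k hk => ?_
    rcases e3 k hk with rfl | rfl
    · exact h1 (e1.1 hk)
    · exact h2 (e2.1 hk)
  have hB := Metric.ball_mem_nhds p h0
  have wit : ∀ w : ℝ × ℝ, ∃ s : ℝ, 0 < s ∧ p + s • w ∈ Metric.ball p ε :=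
    fun w => exists_add_smul w hB
  have cv := convex_ball p ε
  obtain ⟨l, hl⟩ : ∃ R, ∀ a ∈ Metric.ball p ε ∩ {a | 0 < cross2 (D.dir i) (a - p)} ∩
      {a | 0 < cross2 (D.dir j) (a - p)}, D.InRegion a R := by
    refine exists_region ((cv.inter (convex_cross2_pos _ p)).inter
      (convex_cross2_pos _ p)).isPreconnected
      (fun a ⟨⟨h, h1⟩, h2⟩ => compl a h (ne_of_gt h1) (ne_of_gt h2)) ?_
    -- As `j` points to the left of `i`, the direction `dir j - dir i` points to the left of both;
    -- the other three sectors use the analogous sign combinations.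
    obtain ⟨s, hs, h⟩ := wit (D.dir j - D.dir i)
    refine ⟨_, ⟨h, ?_⟩, ?_⟩ <;> simp only [mem_ofPred_eq, add_sub_cancel_left, cross2_smul,
      cross2_sub, cross2_add, cross2_self] <;> nlinarith
  obtain ⟨b, hb⟩ : ∃ R, ∀ a ∈ Metric.ball p ε ∩ {a | cross2 (D.dir i) (a - p) < 0} ∩
      {a | 0 < cross2 (D.dir j) (a - p)}, D.InRegion a R := by
    refine exists_region ((cv.inter (convex_cross2_neg _ p)).inter
      (convex_cross2_pos _ p)).isPreconnected
      (fun a ⟨⟨h, h1⟩, h2⟩ => compl a h (ne_of_lt h1) (ne_of_gt h2)) ?_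
    obtain ⟨s, hs, h⟩ := wit (-D.dir i - D.dir j)
    refine ⟨_, ⟨h, ?_⟩, ?_⟩ <;> simp only [mem_ofPred_eq, add_sub_cancel_left, cross2_smul,
      cross2_sub, cross2_add, cross2_neg, cross2_self] <;> nlinarith
  obtain ⟨r, hr⟩ : ∃ R, ∀ a ∈ Metric.ball p ε ∩ {a | cross2 (D.dir i) (a - p) < 0} ∩
      {a | cross2 (D.dir j) (a - p) < 0}, D.InRegion a R := by
    refine exists_region ((cv.inter (convex_cross2_neg _ p)).inter
      (convex_cross2_neg _ p)).isPreconnected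
      (fun a ⟨⟨h, h1⟩, h2⟩ => compl a h (ne_of_lt h1) (ne_of_lt h2)) ?_
    obtain ⟨s, hs, h⟩ := wit (D.dir i - D.dir j)
    refine ⟨_, ⟨h, ?_⟩, ?_⟩ <;> simp only [mem_ofPred_eq, add_sub_cancel_left, cross2_smul,
      cross2_sub, cross2_add, cross2_self] <;> nlinarith
  obtain ⟨f, hf⟩ : ∃ R, ∀ a ∈ Metric.ball p ε ∩ {a | 0 < cross2 (D.dir i) (a - p)} ∩
      {a | cross2 (D.dir j) (a - p) < 0}, D.InRegion a R := by
    refine exists_region ((cv.inter (convex_cross2_pos _ p)).inter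
      (convex_cross2_neg _ p)).isPreconnected
      (fun a ⟨⟨h, h1⟩, h2⟩ => compl a h (ne_of_gt h1) (ne_of_lt h2)) ?_
    obtain ⟨s, hs, h⟩ := wit (D.dir i + D.dir j)
    refine ⟨_, ⟨h, ?_⟩, ?_⟩ <;> simp only [mem_ofPred_eq, add_sub_cancel_left, cross2_smul,
      cross2_sub, cross2_add, cross2_self] <;> nlinarith
  have reg : ∀ᶠ a in 𝓝 p,
      (0 < cross2 (D.dir i) (a - p) → 0 < cross2 (D.dir j) (a - p) → D.InRegion a l) ∧
      (cross2 (D.dir i) (a - p) < 0 → 0 < cross2 (D.dir j) (a - p) → D.InRegion a b) ∧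
      (cross2 (D.dir i) (a - p) < 0 → cross2 (D.dir j) (a - p) < 0 → D.InRegion a r) ∧
      (0 < cross2 (D.dir i) (a - p) → cross2 (D.dir j) (a - p) < 0 → D.InRegion a f) := by
    filter_upwards [hB] with a ha
    exact ⟨fun h1 h2 => hl a ⟨⟨ha, h1⟩, h2⟩, fun h1 h2 => hb a ⟨⟨ha, h1⟩, h2⟩,
      fun h1 h2 => hr a ⟨⟨ha, h1⟩, h2⟩, fun h1 h2 => hf a ⟨⟨ha, h1⟩, h2⟩⟩
  refine ⟨l, b, r, f, hc, hi, hj, hpos, reg, E, ?_⟩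
  -- At a nearby point `a` of one edge, the sign for the other edge is locally constant. So a
  -- neighbourhood of `a` meets just two sectors, the two sides of the edge.
  filter_upwards [E, eventually_eventually_nhds.2 reg] with a ⟨e1, e2, e3⟩ hreg
  have pos : ∀ k, 0 < cross2 (D.dir k) (a - p) → ∀ᶠ b in 𝓝 a, 0 < cross2 (D.dir k) (b - p) :=
    fun k h => (continuous_cross2 _ _).continuousAt.eventually_const_lt h
  have neg : ∀ k, cross2 (D.dir k) (a - p) < 0 → ∀ᶠ b in 𝓝 a, cross2 (D.dir k) (b - p) < 0 :=
    fun k h => (continuous_cross2 _ _).continuousAt.eventually_lt_const h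
  have base : ∀ k, cross2 (D.dir k) (a - p) = 0 → ∀ b, cross2 (D.dir k) (b - a) =
      cross2 (D.dir k) (b - p) := fun k hk b => by
    rw [cross2_sub] at hk ⊢
    rw [cross2_sub]
    linarith
  have si : cross2 (D.dir i) (a - p) = 0 → cross2 (D.dir j) (a - p) ≠ 0 → D.SimpleOn i a :=
    fun h1 h2 => ⟨e1.2 h1, fun k hk ha => (e3 k ha).elim hk (by rintro rfl; exact h2 (e2.1 ha))⟩
  have sj : cross2 (D.dir j) (a - p) = 0 → cross2 (D.dir i) (a - p) ≠ 0 → D.SimpleOn j a :=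
    fun h1 h2 => ⟨e2.2 h1, fun k hk ha =>
      (e3 k ha).elim (by rintro rfl; exact fun _ => h2 (e1.1 ha)) (fun h _ => hk h) ha⟩
  refine ⟨fun h1 h2 => ⟨si h1 h2.ne', ?_⟩, fun h1 h2 => ⟨si h1 h2.ne, ?_⟩,
    fun h1 h2 => ⟨sj h1 h2.ne', ?_⟩, fun h1 h2 => ⟨sj h1 h2.ne, ?_⟩⟩
  · filter_upwards [hreg, pos j h2] with c h h3
    rw [base i h1]
    exact ⟨fun h4 => h.1 h4 h3, fun h4 => h.2.1 h4 h3⟩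
  · filter_upwards [hreg, neg j h2] with c h h3
    rw [base i h1]
    exact ⟨fun h4 => h.2.2.2 h4 h3, fun h4 => h.2.2.1 h4 h3⟩
  · filter_upwards [hreg, pos i h2] with c h h3
    rw [base j h1]
    exact ⟨fun h4 => h.1 h3 h4, fun h4 => h.2.2.2 h3 h4⟩
  · filter_upwards [hreg, neg i h2] with c h h3
    rw [base j h1]
    exact ⟨fun h4 => h.2.1 h3 h4, fun h4 => h.2.2.1 h3 h4⟩

theorem CrossingChart.leadsInto {i j : D.Edge} {p : ℝ × ℝ} {l b r f : D.Region}
    (h : CrossingChart i j p l b r f) :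
    D.LeadsInto p (D.dir j - D.dir i) l ∧ D.LeadsInto p (-D.dir i - D.dir j) b ∧
      D.LeadsInto p (D.dir i - D.dir j) r ∧ D.LeadsInto p (D.dir i + D.dir j) f := by
  have hpos := h.pos
  have hji : cross2 (D.dir j) (D.dir i) < 0 := by rw [cross2_swap]; linarith
  refine ⟨?_, ?_, ?_, ?_⟩
  · filter_upwards [eventually_add_smul (D.dir j - D.dir i) h.regions,
      eventually_mem_nhdsWithin (a := (0 : ℝ)) (s := Ioi 0)] with s hs h0
    have h0 : 0 < s := h0
    refine hs.1 ?_ ?_ <;> simp only [add_sub_cancel_left, cross2_smul,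
      cross2_sub, cross2_self] <;> nlinarith
  · filter_upwards [eventually_add_smul (-D.dir i - D.dir j) h.regions,
      eventually_mem_nhdsWithin (a := (0 : ℝ)) (s := Ioi 0)] with s hs h0
    have h0 : 0 < s := h0
    refine hs.2.1 ?_ ?_ <;> simp only [add_sub_cancel_left, cross2_smul,
      cross2_sub, cross2_neg, cross2_self] <;> nlinarith
  · filter_upwards [eventually_add_smul (D.dir i - D.dir j) h.regions,
      eventually_mem_nhdsWithin (a := (0 : ℝ)) (s := Ioi 0)] with s hs h0
    have h0 : 0 < s := h0
    refine hs.2.2.1 ?_ ?_ <;> simp only [add_sub_cancel_left, cross2_smul,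
      cross2_sub, cross2_self] <;> nlinarith
  · filter_upwards [eventually_add_smul (D.dir i + D.dir j) h.regions,
      eventually_mem_nhdsWithin (a := (0 : ℝ)) (s := Ioi 0)] with s hs h0
    have h0 : 0 < s := h0
    refine hs.2.2.2 ?_ ?_ <;> simp only [add_sub_cancel_left, cross2_smul,
      cross2_add, cross2_self] <;> nlinarith

/-- The situation near a point `p` which is not a crossing, on the edge `i`: the diagram looks like
one strand, given by an equation `h = 0`, which separates two regions. -/
structure StrandChart (i : D.Edge) (p : ℝ × ℝ) (R' R : D.Region) (h : ℝ × ℝ → ℝ) : Prop where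
  continuous : Continuous h
  ne_zero : ∀ᶠ a in 𝓝 p, a ∈ D.complement → h a ≠ 0
  sides : ∀ᶠ a in 𝓝 p, ∀ k, D.SimpleOn k a → Equiv.Perm.SameCycle D.next i k ∧ D.Sides k a R' R ∧
    ∀ᶠ b in 𝓝 a, (0 < cross2 (D.dir k) (b - a) → 0 < h b) ∧
      (cross2 (D.dir k) (b - a) < 0 → h b < 0)

/-- Each sign of `h` gives a connected piece of a small ball, hence one region. The hypothesis `sg`
translates left and right of an edge into the sign of `h`, which identifies the two sides at all
nearby edge points. -/
theorem exists_strandChart_of {i : D.Edge} {p : ℝ × ℝ} {h : ℝ × ℝ → ℝ} (hc : Continuous h)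
    (hU : ∀ᶠ a in 𝓝 p, a ∈ D.complement ↔ h a ≠ 0)
    (pos : ∀ ε > 0, IsConnected (Metric.ball p ε ∩ {a | 0 < h a}))
    (neg : ∀ ε > 0, IsConnected (Metric.ball p ε ∩ {a | h a < 0}))
    (sg : ∀ᶠ a in 𝓝 p, ∀ k, D.SimpleOn k a → Equiv.Perm.SameCycle D.next i k ∧
      ∀ᶠ b in 𝓝 a, (0 < cross2 (D.dir k) (b - a) → 0 < h b) ∧
        (cross2 (D.dir k) (b - a) < 0 → h b < 0)) :
    ∃ R' R, StrandChart i p R' R h := by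
  obtain ⟨ε, h0, hε⟩ := Metric.eventually_nhds_iff_ball.1 hU
  obtain ⟨R', hR'⟩ := exists_region (P := D.toOrientedPolygons) (pos ε h0).isPreconnected
    (fun a ha => (hε a ha.1).2 (ne_of_gt ha.2)) (pos ε h0).nonempty
  obtain ⟨R, hR⟩ := exists_region (P := D.toOrientedPolygons) (neg ε h0).isPreconnected
    (fun a ha => (hε a ha.1).2 (ne_of_lt ha.2)) (neg ε h0).nonempty
  have reg : ∀ᶠ a in 𝓝 p, (0 < h a → D.InRegion a R') ∧ (h a < 0 → D.InRegion a R) := by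
    filter_upwards [Metric.ball_mem_nhds p h0] with a ha
    exact ⟨fun h => hR' a ⟨ha, h⟩, fun h => hR a ⟨ha, h⟩⟩
  refine ⟨R', R, hc, hU.mono fun _ h => h.1, ?_⟩
  filter_upwards [sg, eventually_eventually_nhds.2 reg] with a ha hreg k hk
  obtain ⟨h1, h2⟩ := ha k hk
  refine ⟨h1, ⟨hk, ?_⟩, h2⟩
  filter_upwards [h2, hreg] with b hb hb'
  exact ⟨fun h => hb'.1 (hb.1 h), fun h => hb'.2 (hb.2 h)⟩

theorem nonempty_ball_inter {p : ℝ × ℝ} {ε : ℝ} (h0 : 0 < ε) (w : ℝ × ℝ) {Q : ℝ × ℝ → Prop}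
    (hQ : ∀ s : ℝ, 0 < s → Q (p + s • w)) : (Metric.ball p ε ∩ {a | Q a}).Nonempty := by
  obtain ⟨s, hs, h⟩ := exists_add_smul w (Metric.ball_mem_nhds p h0)
  exact ⟨_, h, hQ s hs⟩

theorem cross2_rot_pos {d : ℝ × ℝ} (hd : d ≠ 0) : 0 < cross2 d (-d.2, d.1) := by
  have : d.1 ≠ 0 ∨ d.2 ≠ 0 := by
    by_contra! h
    exact hd (Prod.ext h.1 h.2)
  simp only [cross2]
  rcases this with h | h <;> nlinarith [mul_self_pos.2 h, mul_self_nonneg d.1, mul_self_nonneg d.2]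

theorem isConnected_cross2_pos (p : ℝ × ℝ) {d : ℝ × ℝ} (hd : d ≠ 0) {ε : ℝ} (h0 : 0 < ε) :
    IsConnected (Metric.ball p ε ∩ {a | 0 < cross2 d (a - p)}) :=
  ⟨nonempty_ball_inter h0 (-d.2, d.1) fun s hs => by
      rw [add_sub_cancel_left, cross2_smul]; exact mul_pos hs (cross2_rot_pos hd),
    ((convex_ball p ε).inter (convex_cross2_pos d p)).isPreconnected⟩

theorem isConnected_cross2_neg (p : ℝ × ℝ) {d : ℝ × ℝ} (hd : d ≠ 0) {ε : ℝ} (h0 : 0 < ε) :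
    IsConnected (Metric.ball p ε ∩ {a | cross2 d (a - p) < 0}) := by
  simpa [cross2_neg_left] using isConnected_cross2_pos p (neg_ne_zero.2 hd) h0

theorem isConnected_min_pos (p : ℝ × ℝ) {d e w : ℝ × ℝ} (hd : 0 < cross2 d w) (he : 0 < cross2 e w)
    {ε : ℝ} (h0 : 0 < ε) :
    IsConnected (Metric.ball p ε ∩ {a | 0 < min (cross2 d (a - p)) (cross2 e (a - p))}) := by
  refine ⟨nonempty_ball_inter h0 w fun s hs => ?_, ?_⟩
  · rw [add_sub_cancel_left, cross2_smul, cross2_smul]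
    exact lt_min (mul_pos hs hd) (mul_pos hs he)
  · simp only [lt_min_iff, ofPred_and]
    exact ((convex_ball p ε).inter
      ((convex_cross2_pos d p).inter (convex_cross2_pos e p))).isPreconnected

/-- The set need not be convex, but it is a union of two half-balls with a common point in direction
`w`. -/
theorem isConnected_max_pos (p : ℝ × ℝ) {d e w : ℝ × ℝ} (hd : 0 < cross2 d w) (he : 0 < cross2 e w)
    {ε : ℝ} (h0 : 0 < ε) :
    IsConnected (Metric.ball p ε ∩ {a | 0 < max (cross2 d (a - p)) (cross2 e (a - p))}) := by
  simp only [lt_max_iff, ofPred_or, inter_union_distrib_left]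
  obtain ⟨s, hs, h⟩ := exists_add_smul w (Metric.ball_mem_nhds p h0)
  have hd0 : d ≠ 0 := by rintro rfl; simp [cross2] at hd
  have he0 : e ≠ 0 := by rintro rfl; simp [cross2] at he
  refine (isConnected_cross2_pos p hd0 h0).union ⟨_, ⟨h, ?_⟩, ⟨h, ?_⟩⟩
    (isConnected_cross2_pos p he0 h0)
  · simpa [cross2_smul] using mul_pos hs hd
  · simpa [cross2_smul] using mul_pos hs he

theorem isConnected_max_neg (p : ℝ × ℝ) {d e w : ℝ × ℝ} (hd : cross2 d w < 0) (he : cross2 e w < 0)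
    {ε : ℝ} (h0 : 0 < ε) :
    IsConnected (Metric.ball p ε ∩ {a | max (cross2 d (a - p)) (cross2 e (a - p)) < 0}) := by
  have := isConnected_min_pos p (d := -d) (e := -e) (w := w) (by rw [cross2_neg_left]; linarith)
    (by rw [cross2_neg_left]; linarith) h0
  simpa [cross2_neg_left] using this

theorem isConnected_min_neg (p : ℝ × ℝ) {d e w : ℝ × ℝ} (hd : cross2 d w < 0) (he : cross2 e w < 0)
    {ε : ℝ} (h0 : 0 < ε) :
    IsConnected (Metric.ball p ε ∩ {a | min (cross2 d (a - p)) (cross2 e (a - p)) < 0}) := by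
  have := isConnected_max_pos p (d := -d) (e := -e) (w := w) (by rw [cross2_neg_left]; linarith)
    (by rw [cross2_neg_left]; linarith) h0
  simpa [cross2_neg_left] using this

theorem exists_strandChart_of_simpleOn {i : D.Edge} {p : ℝ × ℝ} (hp : D.SimpleOn i p) :
    ∃ R' R h, StrandChart i p R' R h := by
  have E : ∀ᶠ a in 𝓝 p, (a ∈ D.side i ↔ cross2 (D.dir i) (a - p) = 0) ∧
      ∀ k, a ∈ D.side k → k = i := by
    filter_upwards [eventually_mem_side_interior (exists_interior_of_simpleOn hp),
      eventually_mem_side (P := D.toOrientedPolygons) p] with a h1 h2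
    exact ⟨h1, fun k hk => by_contra fun hne => hp.2 k hne (h2 k hk)⟩
  obtain ⟨R', R, h⟩ := exists_strandChart_of (i := i) (p := p)
    (h := fun a => cross2 (D.dir i) (a - p)) (continuous_cross2 _ _)
    (by
      filter_upwards [E] with a ⟨h1, h2⟩
      rw [mem_complement, ne_eq, ← h1]
      exact ⟨fun h => h i, fun h k hk => h (h2 k hk ▸ hk)⟩)
    (fun ε h0 => isConnected_cross2_pos p (dir_ne_zero i) h0)
    (fun ε h0 => isConnected_cross2_neg p (dir_ne_zero i) h0)
    (by
      filter_upwards [E] with a ⟨h1, h2⟩ k hk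
      obtain rfl := h2 k hk.1
      have h3 := h1.1 hk.1
      refine ⟨Equiv.Perm.SameCycle.refl _ _, Eventually.of_forall fun b => ?_⟩
      rw [cross2_sub] at h3 ⊢
      rw [cross2_sub]
      constructor <;> intro <;> linarith)
  exact ⟨R', R, _, h⟩

/-- Left of a bent strand is the intersection of the two left half-planes at a left turn, and their
union at a right turn. So the equation is the minimum or the maximum of the two linear forms, or one
form alone if the strand goes straight on. -/
theorem exists_strandChart_vertex (i : D.Edge) :
    ∃ R' R h, StrandChart i (D.pt (D.next i)) R' R h := by
  obtain ⟨j, hj⟩ : ∃ j, j = D.next i := ⟨_, rfl⟩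
  obtain ⟨p, hp⟩ : ∃ p, p = D.pt j := ⟨_, rfl⟩
  rw [← hj, ← hp]
  have hij : i ≠ j := fun h => D.next_ne i (hj ▸ h.symm)
  have hcyc : Equiv.Perm.SameCycle D.next i j := by
    rw [hj]; exact (Equiv.Perm.SameCycle.refl _ _).apply_right
  have hpi : p ∈ D.side i := by rw [hp, hj]; exact end_mem_side i
  have hpj : p ∈ D.side j := by rw [hp]; exact start_mem_side j
  have ei : ∀ᶠ a in 𝓝 p, (a ∈ D.side i ↔ ∃ s : ℝ, s ≤ 0 ∧ a = p + s • D.dir i) := by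
    have := eventually_mem_side_end i
    rwa [← hj, ← hp] at this
  have ej : ∀ᶠ a in 𝓝 p, (a ∈ D.side j ↔ ∃ s : ℝ, 0 ≤ s ∧ a = p + s • D.dir j) := by
    have := eventually_mem_side_start j
    rwa [← hp] at this
  have ek : ∀ᶠ a in 𝓝 p, ∀ k, a ∈ D.side k → k = i ∨ k = j := by
    filter_upwards [eventually_mem_side (P := D.toOrientedPolygons) p] with a h k hk
    by_contra! hne
    have := D.no_triple_point i j k hij hne.2.symm hne.1.symm
    exact (this ▸ (⟨⟨hpi, hpj⟩, h k hk⟩ : p ∈ D.side i ∩ D.side j ∩ D.side k) : p ∈ (∅ : Set _))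
  have hsimple : ∀ k, ¬ D.SimpleOn k p := fun k hk =>
    SimpleOn.notMem_multiplePoints hk ⟨i, j, hij, hpi, hpj⟩
  have compl : ∀ᶠ a in 𝓝 p, a ∈ D.complement ↔ ¬ (a ∈ D.side i ∨ a ∈ D.side j) := by
    filter_upwards [ek] with a h
    rw [mem_complement]
    exact ⟨fun h1 h2 => h2.elim (h1 i) (h1 j), fun h1 k hk =>
      (h k hk).elim (fun e => h1 (Or.inl (e ▸ hk))) fun e => h1 (Or.inr (e ▸ hk))⟩
  obtain ⟨c, hc⟩ : ∃ c, c = cross2 (D.dir i) (D.dir j) := ⟨_, rfl⟩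
  have hc' : cross2 (D.dir j) (D.dir i) = -c := by rw [cross2_swap, hc]
  have on_i : ∀ (s : ℝ) (a : ℝ × ℝ), a = p + s • D.dir i →
      cross2 (D.dir i) (a - p) = 0 ∧ cross2 (D.dir j) (a - p) = s * -c := by
    rintro s a rfl
    simp [cross2_smul, hc']
  have on_j : ∀ (s : ℝ) (a : ℝ × ℝ), a = p + s • D.dir j →
      cross2 (D.dir j) (a - p) = 0 ∧ cross2 (D.dir i) (a - p) = s * c := by
    rintro s a rfl
    simp [cross2_smul, hc]
  have base : ∀ k a, cross2 (D.dir k) (a - p) = 0 → ∀ b, cross2 (D.dir k) (b - a) =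
      cross2 (D.dir k) (b - p) := fun k a hk b => by
    rw [cross2_sub] at hk ⊢
    rw [cross2_sub]
    linarith
  have lt_near : ∀ k l a, cross2 (D.dir k) (a - p) < cross2 (D.dir l) (a - p) →
      ∀ᶠ b in 𝓝 a, cross2 (D.dir k) (b - p) < cross2 (D.dir l) (b - p) := fun k l a h =>
    (continuous_cross2 _ _).continuousAt.eventually_lt (continuous_cross2 _ _).continuousAt h
  rcases lt_trichotomy c 0 with h0 | h0 | h0
  · obtain ⟨R', R, h⟩ := exists_strandChart_of (i := i) (p := p)
      (h := fun a => max (cross2 (D.dir i) (a - p)) (cross2 (D.dir j) (a - p)))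
      ((continuous_cross2 _ _).max (continuous_cross2 _ _))
      (by
        filter_upwards [compl, ei, ej] with a h1 h2 h3
        rw [h1, not_iff_not, h2, h3]
        constructor
        · rintro (⟨s, hs, h⟩ | ⟨s, hs, h⟩)
          · obtain ⟨h4, h5⟩ := on_i s a h
            rw [h4, h5, max_eq_left (by nlinarith)]
          · obtain ⟨h4, h5⟩ := on_j s a h
            rw [h4, h5, max_eq_right (by nlinarith)]
        · intro h
          rcases max_eq_iff.1 h with ⟨h4, h5⟩ | ⟨h4, h5⟩
          · obtain ⟨s, hs⟩ := exists_smul_of_cross2 h4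
            refine Or.inl ⟨s, ?_, hs⟩
            rw [(on_i s a hs).2] at h5
            nlinarith
          · obtain ⟨s, hs⟩ := exists_smul_of_cross2 h4
            refine Or.inr ⟨s, ?_, hs⟩
            rw [(on_j s a hs).2] at h5
            nlinarith)
      (fun ε hε => isConnected_max_pos p (w := D.dir i - D.dir j)
        (by rw [cross2_sub, cross2_self, ← hc]; linarith)
        (by rw [cross2_sub, cross2_self, hc']; linarith) hε)
      (fun ε hε => isConnected_max_neg p (w := D.dir j - D.dir i)
        (by rw [cross2_sub, cross2_self, ← hc]; linarith)
        (by rw [cross2_sub, cross2_self, hc']; linarith) hε)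
      (by
        filter_upwards [ek, ei, ej] with a h1 h2 h3 k hk
        have hap : a ≠ p := fun h => hsimple k (h ▸ hk)
        rcases h1 k hk.1 with rfl | rfl
        · refine ⟨Equiv.Perm.SameCycle.refl _ _, ?_⟩
          obtain ⟨s, hs, h⟩ := h2.1 hk.1
          have hs : s < 0 := lt_of_le_of_ne hs (by rintro rfl; simp at h; exact hap h)
          obtain ⟨h4, h5⟩ := on_i s a h
          filter_upwards [lt_near j k a (by rw [h4, h5]; nlinarith)] with b hb
          rw [max_eq_left hb.le, base k a h4]
          exact ⟨id, id⟩
        · refine ⟨hcyc, ?_⟩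
          obtain ⟨s, hs, h⟩ := h3.1 hk.1
          have hs : 0 < s := lt_of_le_of_ne hs (by rintro rfl; simp at h; exact hap h)
          obtain ⟨h4, h5⟩ := on_j s a h
          filter_upwards [lt_near i k a (by rw [h4, h5]; nlinarith)] with b hb
          rw [max_eq_right hb.le, base k a h4]
          exact ⟨id, id⟩)
    exact ⟨R', R, _, h⟩
  · obtain ⟨m, hm⟩ := exists_smul_of_cross2_eq_zero (dir_ne_zero i) (hc.symm.trans h0)
    -- Positivity of `m` makes the two edges together cover the line on both sides of `p`.
    have hm0 : 0 < m := not_antiparallel (i := i) (by rw [← hj, hm])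
    have hdj : ∀ v, cross2 (D.dir j) v = m * cross2 (D.dir i) v := fun v => by
      rw [hm]; simp [cross2]; ring
    obtain ⟨R', R, h⟩ := exists_strandChart_of (i := i) (p := p)
      (h := fun a => cross2 (D.dir i) (a - p)) (continuous_cross2 _ _)
      (by
        filter_upwards [compl, ei, ej] with a h1 h2 h3
        rw [h1, not_iff_not, h2, h3]
        constructor
        · rintro (⟨s, hs, h⟩ | ⟨s, hs, h⟩)
          · exact (on_i s a h).1
          · rw [(on_j s a h).2, h0, mul_zero]
        · intro h
          obtain ⟨s, hs⟩ := exists_smul_of_cross2 h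
          rcases le_total s 0 with h4 | h4
          · exact Or.inl ⟨s, h4, hs⟩
          · exact Or.inr ⟨s / m, div_nonneg h4 hm0.le, by
              rw [hm, smul_smul, div_mul_cancel₀ _ hm0.ne', hs]⟩)
      (fun ε h0 => isConnected_cross2_pos p (dir_ne_zero i) h0)
      (fun ε h0 => isConnected_cross2_neg p (dir_ne_zero i) h0)
      (by
        filter_upwards [ek, ei, ej] with a h1 h2 h3 k hk
        rcases h1 k hk.1 with rfl | rfl
        · refine ⟨Equiv.Perm.SameCycle.refl _ _, Eventually.of_forall fun b => ?_⟩
          obtain ⟨s, hs, h⟩ := h2.1 hk.1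
          rw [base k a (on_i s a h).1]
          exact ⟨id, id⟩
        · refine ⟨hcyc, Eventually.of_forall fun b => ?_⟩
          obtain ⟨s, hs, h⟩ := h3.1 hk.1
          rw [base k a (on_j s a h).1, hdj]
          exact ⟨fun h => pos_of_mul_pos_right h hm0.le, fun h => by
            by_contra h'
            exact absurd h (not_lt.2 (mul_nonneg hm0.le (not_lt.1 h')))⟩)
    exact ⟨R', R, _, h⟩
  · obtain ⟨R', R, h⟩ := exists_strandChart_of (i := i) (p := p)
      (h := fun a => min (cross2 (D.dir i) (a - p)) (cross2 (D.dir j) (a - p)))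
      ((continuous_cross2 _ _).min (continuous_cross2 _ _))
      (by
        filter_upwards [compl, ei, ej] with a h1 h2 h3
        rw [h1, not_iff_not, h2, h3]
        constructor
        · rintro (⟨s, hs, h⟩ | ⟨s, hs, h⟩)
          · obtain ⟨h4, h5⟩ := on_i s a h
            rw [h4, h5, min_eq_left (by nlinarith)]
          · obtain ⟨h4, h5⟩ := on_j s a h
            rw [h4, h5, min_eq_right (by nlinarith)]
        · intro h
          rcases min_eq_iff.1 h with ⟨h4, h5⟩ | ⟨h4, h5⟩
          · obtain ⟨s, hs⟩ := exists_smul_of_cross2 h4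
            refine Or.inl ⟨s, ?_, hs⟩
            rw [(on_i s a hs).2] at h5
            nlinarith
          · obtain ⟨s, hs⟩ := exists_smul_of_cross2 h4
            refine Or.inr ⟨s, ?_, hs⟩
            rw [(on_j s a hs).2] at h5
            nlinarith)
      (fun ε hε => isConnected_min_pos p (w := D.dir j - D.dir i)
        (by rw [cross2_sub, cross2_self, ← hc]; linarith)
        (by rw [cross2_sub, cross2_self, hc']; linarith) hε)
      (fun ε hε => isConnected_min_neg p (w := D.dir i - D.dir j)
        (by rw [cross2_sub, cross2_self, ← hc]; linarith)
        (by rw [cross2_sub, cross2_self, hc']; linarith) hε)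
      (by
        filter_upwards [ek, ei, ej] with a h1 h2 h3 k hk
        have hap : a ≠ p := fun h => hsimple k (h ▸ hk)
        rcases h1 k hk.1 with rfl | rfl
        · refine ⟨Equiv.Perm.SameCycle.refl _ _, ?_⟩
          obtain ⟨s, hs, h⟩ := h2.1 hk.1
          have hs : s < 0 := lt_of_le_of_ne hs (by rintro rfl; simp at h; exact hap h)
          obtain ⟨h4, h5⟩ := on_i s a h
          filter_upwards [lt_near k j a (by rw [h4, h5]; nlinarith)] with b hb
          rw [min_eq_left hb.le, base k a h4]
          exact ⟨id, id⟩
        · refine ⟨hcyc, ?_⟩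
          obtain ⟨s, hs, h⟩ := h3.1 hk.1
          have hs : 0 < s := lt_of_le_of_ne hs (by rintro rfl; simp at h; exact hap h)
          obtain ⟨h4, h5⟩ := on_j s a h
          filter_upwards [lt_near k i a (by rw [h4, h5]; nlinarith)] with b hb
          rw [min_eq_right hb.le, base k a h4]
          exact ⟨id, id⟩)
    exact ⟨R', R, _, h⟩

end LinkDiagram

/-! ### Sections of flat systems of transitions -/

namespace LinkDiagram

open OrientedPolygons

variable {D : LinkDiagram} {S : Type*}

variable (D) in
/-- The component that an edge belongs to. -/
def comp (i : D.Edge) : D.Component := Quotient.mk (Equiv.Perm.SameCycle.setoid D.next) i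

theorem comp_eq_iff {i k : D.Edge} : D.comp i = D.comp k ↔ Equiv.Perm.SameCycle D.next i k :=
  Quotient.eq (r := Equiv.Perm.SameCycle.setoid D.next)

theorem exists_strandChart {i : D.Edge} {p : ℝ × ℝ}
    (h : D.SimpleOn i p ∨ p = D.pt (D.next i)) : ∃ R' R h, StrandChart i p R' R h := by
  rcases h with h | rfl
  · exact exists_strandChart_of_simpleOn h
  · exact exists_strandChart_vertex i

theorem exists_sides {i : D.Edge} {p : ℝ × ℝ} (hp : D.SimpleOn i p) :
    ∃ R' R, D.Sides i p R' R := by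
  obtain ⟨R', R, h, hc⟩ := exists_strandChart_of_simpleOn hp
  exact ⟨R', R, (hc.sides.self_of_nhds i hp).2.1⟩

theorem Sides.exists_left {i : D.Edge} {p : ℝ × ℝ} {R' R : D.Region} (h : D.Sides i p R' R)
    {Q : ℝ × ℝ → Prop} (hQ : ∀ᶠ a in 𝓝 p, 0 < cross2 (D.dir i) (a - p) → Q a) :
    ∃ a, D.InRegion a R' ∧ Q a := by
  obtain ⟨s, hs, h1, h2⟩ := exists_add_smul (-(D.dir i).2, (D.dir i).1) (h.2.and hQ)
  have : 0 < cross2 (D.dir i) (p + s • (-(D.dir i).2, (D.dir i).1) - p) := by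
    rw [add_sub_cancel_left, cross2_smul]
    exact mul_pos hs (cross2_rot_pos (dir_ne_zero i))
  exact ⟨_, h1.1 this, h2 this⟩

theorem Sides.exists_right {i : D.Edge} {p : ℝ × ℝ} {R' R : D.Region} (h : D.Sides i p R' R)
    {Q : ℝ × ℝ → Prop} (hQ : ∀ᶠ a in 𝓝 p, cross2 (D.dir i) (a - p) < 0 → Q a) :
    ∃ a, D.InRegion a R ∧ Q a := by
  obtain ⟨s, hs, h1, h2⟩ := exists_add_smul (-(-(D.dir i).2, (D.dir i).1)) (h.2.and hQ)
  have : cross2 (D.dir i) (p + s • -(-(D.dir i).2, (D.dir i).1) - p) < 0 := by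
    rw [add_sub_cancel_left, cross2_smul, cross2_neg]
    nlinarith [cross2_rot_pos (dir_ne_zero i)]
  exact ⟨_, h1.2 this, h2 this⟩

theorem Sides.unique {i : D.Edge} {p : ℝ × ℝ} {R' R Q' Q : D.Region} (h : D.Sides i p R' R)
    (h' : D.Sides i p Q' Q) : R' = Q' ∧ R = Q := by
  obtain ⟨a, h1, h2⟩ := Sides.exists_left h (h'.2.mono fun _ h => h.1)
  obtain ⟨b, h3, h4⟩ := Sides.exists_right h (h'.2.mono fun _ h => h.2)
  exact ⟨h1.unique h2, h3.unique h4⟩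

theorem mem_complement_or_simpleOn {p : ℝ × ℝ} (h : p ∉ D.multiplePoints) :
    p ∈ D.complement ∨ ∃ i, D.SimpleOn i p := by
  by_cases hp : p ∈ D.complement
  · exact Or.inl hp
  · rw [mem_complement] at hp
    push Not at hp
    obtain ⟨i, hi⟩ := hp
    exact Or.inr ⟨i, simpleOn_of_notMem_multiplePoints h hi⟩

/-- Multiple points are finite in number, so an open set contains a point of a region or a simple
edge point, which has regions next to it. -/
theorem dense_complement : Dense D.complement := by
  refine dense_iff_inter_open.2 fun W hW hne => ?_
  obtain ⟨p, hpW, hp⟩ :=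
    (D.finite_multiplePoints.countable.dense_compl ℝ).inter_open_nonempty W hW hne
  rcases mem_complement_or_simpleOn hp with h | ⟨i, hi⟩
  · exact ⟨p, hpW, h⟩
  · obtain ⟨R', R, h⟩ := exists_sides hi
    obtain ⟨a, ha, haW⟩ := Sides.exists_left h ((hW.eventually_mem hpW).mono fun _ h _ => h)
    exact ⟨a, haW, ha.1⟩

/-- `G` is near `p` a section of the system with the transitions `t k R' R` from the region `R`, on
the right of an edge of the component `k`, to the region `R'` on its left. -/
structure IsSectionAt (t : D.Component → D.Region → D.Region → Equiv.Perm S) (G : ℝ × ℝ → S)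
    (p : ℝ × ℝ) : Prop where
  region : p ∈ D.complement → ∀ᶠ a in 𝓝 p, G a = G p
  edge : ∀ i R' R, D.Sides i p R' R → ∃ s, ∀ᶠ a in 𝓝 p,
    (0 < cross2 (D.dir i) (a - p) → G a = t (D.comp i) R' R s) ∧
    (cross2 (D.dir i) (a - p) < 0 → G a = s)

/-- Going around a crossing, the transitions cancel. -/
def IsFlat (t : D.Component → D.Region → D.Region → Equiv.Perm S) : Prop :=
  ∀ i j p l b r f, CrossingChart i j p l b r f → ∀ s,
    t (D.comp i) l b (t (D.comp j) b r s) = t (D.comp j) l f (t (D.comp i) f r s)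

variable {t : D.Component → D.Region → D.Region → Equiv.Perm S}

theorem IsSectionAt.congr {G G' : ℝ × ℝ → S} {p : ℝ × ℝ}
    (h : ∀ᶠ a in 𝓝 p, a ∈ D.complement → G a = G' a) (hG : IsSectionAt t G p) :
    IsSectionAt t G' p := by
  refine ⟨fun hp => ?_, fun i R' R hs => ?_⟩
  · filter_upwards [h, hG.region hp, D.isOpen_complement.mem_nhds hp] with a h1 h2 h3
    rw [← h1 h3, ← h.self_of_nhds hp, h2]
  · obtain ⟨s, hs'⟩ := hG.edge i R' R hs
    refine ⟨s, ?_⟩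
    filter_upwards [h, hs', hs.2] with a h1 h2 h3
    exact ⟨fun h => by rw [← h1 (h3.1 h).1, h2.1 h], fun h => by rw [← h1 (h3.2 h).1, h2.2 h]⟩

/-- Both agreement and disagreement cross an edge, since transitions are injective. Without the
finitely many multiple points `V` is still connected, so vertices and crossings need not be
examined. -/
theorem IsSectionAt.eq_of_convex {V : Set (ℝ × ℝ)} (hV : IsOpen V) (hc : Convex ℝ V)
    {G G' : ℝ × ℝ → S} (hG : ∀ p ∈ V, IsSectionAt t G p) (hG' : ∀ p ∈ V, IsSectionAt t G' p)
    {q : ℝ × ℝ} (hq : q ∈ V ∩ D.complement) (h : G q = G' q) {a : ℝ × ℝ}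
    (ha : a ∈ V ∩ D.complement) : G a = G' a := by
  have hmul : ∀ a ∈ D.complement, a ∉ D.multiplePoints := by
    rintro a ha ⟨i, -, -, hi, -⟩
    exact mem_complement.1 ha i hi
  let A : Set (ℝ × ℝ) := {p | ∀ᶠ a in 𝓝 p, a ∈ D.complement → G a = G' a}
  let B : Set (ℝ × ℝ) := {p | ∀ᶠ a in 𝓝 p, a ∈ D.complement → G a ≠ G' a}
  have hA : IsOpen A := isOpen_setOfPred_eventually_nhds
  have hB : IsOpen B := isOpen_setOfPred_eventually_nhds
  have hAB : Disjoint A B := by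
    refine disjoint_left.2 fun p h1 h2 => ?_
    obtain ⟨W, hW, hWo, hpW⟩ := eventually_nhds_iff.1 (h1.and h2)
    obtain ⟨a, haW, ha⟩ := D.dense_complement.inter_open_nonempty W hWo ⟨p, hpW⟩
    exact (hW a haW).2 ha ((hW a haW).1 ha)
  have hpre := hc.isPreconnected_diff_countable (by simp [one_add_one_eq_two]) hV
    D.finite_multiplePoints.countable
  have hreg : ∀ p ∈ V, p ∈ D.complement → (G p = G' p → p ∈ A) ∧ (G p ≠ G' p → p ∈ B) := by
    intro p hp hpU
    constructor <;> intro he <;>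
      filter_upwards [(hG p hp).region hpU, (hG' p hp).region hpU] with a h1 h2 _ <;>
      rwa [h1, h2]
  have hcov : V \ D.multiplePoints ⊆ A ∪ B := by
    rintro p ⟨hp, hpm⟩
    rcases mem_complement_or_simpleOn hpm with hpU | ⟨i, hi⟩
    · by_cases he : G p = G' p
      · exact Or.inl ((hreg p hp hpU).1 he)
      · exact Or.inr ((hreg p hp hpU).2 he)
    · obtain ⟨R', R, hs⟩ := exists_sides hi
      obtain ⟨s, hs1⟩ := (hG p hp).edge i R' R hs
      obtain ⟨s', hs2⟩ := (hG' p hp).edge i R' R hs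
      have hside : ∀ᶠ a in 𝓝 p, a ∈ D.complement → cross2 (D.dir i) (a - p) ≠ 0 := by
        filter_upwards [eventually_mem_side_interior (exists_interior_of_simpleOn hi)]
          with a h1 h2 h3
        exact mem_complement.1 h2 i (h1.2 h3)
      by_cases he : s = s'
      · refine Or.inl ?_
        filter_upwards [hs1, hs2, hside] with a h1 h2 h3 haU
        rcases (h3 haU).lt_or_gt with h | h
        · rw [h1.2 h, h2.2 h, he]
        · rw [h1.1 h, h2.1 h, he]
      · refine Or.inr ?_
        filter_upwards [hs1, hs2, hside] with a h1 h2 h3 haU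
        rcases (h3 haU).lt_or_gt with h | h
        · rwa [h1.2 h, h2.2 h]
        · rwa [h1.1 h, h2.1 h, (Equiv.injective _).ne_iff]
  have hsub : V \ D.multiplePoints ⊆ A := hpre.subset_left_of_subset_union hA hB hAB hcov
    ⟨q, ⟨hq.1, hmul q hq.2⟩, (hreg q hq.1 hq.2).1 h⟩
  exact (hsub ⟨ha.1, hmul a ha.2⟩).self_of_nhds ha.2

theorem exists_local_section_complement {p : ℝ × ℝ} (hp : p ∈ D.complement) :
    ∃ V, IsOpen V ∧ p ∈ V ∧ ∀ q ∈ V ∩ D.complement, ∀ s : S, ∃ G,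
      (∀ p' ∈ V, IsSectionAt t G p') ∧ G q = s := by
  refine ⟨D.complement, D.isOpen_complement, hp, fun q _ s => ⟨fun _ => s, fun p' hp' => ?_, rfl⟩⟩
  exact ⟨fun _ => Eventually.of_forall fun _ => rfl,
    fun i R' R hs => absurd hs.1.1 (mem_complement.1 hp' i)⟩

theorem exists_local_section_strand {i : D.Edge} {p : ℝ × ℝ} {R' R : D.Region} {h : ℝ × ℝ → ℝ}
    (hc : StrandChart i p R' R h) :
    ∃ V, IsOpen V ∧ p ∈ V ∧ ∀ q ∈ V ∩ D.complement, ∀ s : S, ∃ G,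
      (∀ p' ∈ V, IsSectionAt t G p') ∧ G q = s := by
  classical
  obtain ⟨V, hV, hVo, hpV⟩ := eventually_nhds_iff.1 (hc.ne_zero.and hc.sides)
  refine ⟨V, hVo, hpV, fun q hq s => ?_⟩
  let F : S → ℝ × ℝ → S := fun z a => if 0 < h a then t (D.comp i) R' R z else z
  refine ⟨F (if 0 < h q then (t (D.comp i) R' R).symm s else s), fun p' hp' => ?_, ?_⟩
  · obtain ⟨h1, h2⟩ := hV p' hp'
    refine ⟨fun hU => ?_, fun k Q' Q hs => ?_⟩
    · rcases (h1 hU).lt_or_gt with h0 | h0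
      · filter_upwards [hc.continuous.continuousAt.eventually_lt_const h0] with a ha
        simp [F, ha.not_gt, h0.not_gt]
      · filter_upwards [hc.continuous.continuousAt.eventually_const_lt h0] with a ha
        simp [F, ha, h0]
    · obtain ⟨h3, h4, h5⟩ := h2 k hs.1
      obtain ⟨rfl, rfl⟩ := Sides.unique hs h4
      rw [← comp_eq_iff.2 h3]
      refine ⟨if 0 < h q then (t (D.comp i) Q' Q).symm s else s, ?_⟩
      filter_upwards [h5] with a ha
      exact ⟨fun h => by simp only [F]; rw [if_pos (ha.1 h)],
        fun h => by simp only [F]; rw [if_neg (ha.2 h).not_gt]⟩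
  · by_cases h0 : 0 < h q <;> simp [F, h0]

theorem exists_local_section_crossing (ht : IsFlat t) {i j : D.Edge} {p : ℝ × ℝ}
    {l b r f : D.Region} (hc : CrossingChart i j p l b r f) :
    ∃ V, IsOpen V ∧ p ∈ V ∧ ∀ q ∈ V ∩ D.complement, ∀ s : S, ∃ G,
      (∀ p' ∈ V, IsSectionAt t G p') ∧ G q = s := by
  classical
  obtain ⟨V, hV, hVo, hpV⟩ := eventually_nhds_iff.1 (hc.mem_side.and hc.sides)
  refine ⟨V, hVo, hpV, fun q hq s => ?_⟩
  let u : ℝ × ℝ → ℝ := fun a => cross2 (D.dir i) (a - p)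
  let v : ℝ × ℝ → ℝ := fun a => cross2 (D.dir j) (a - p)
  have hu : Continuous u := continuous_cross2 _ _
  have hv : Continuous v := continuous_cross2 _ _
  -- `M a` transports from the sector `r` to the sector of `a`. For `l` the route through `b` is
  -- chosen; flatness is needed only at the border between `l` and `f`.
  let M : ℝ × ℝ → Equiv.Perm S := fun a =>
    if 0 < u a then if 0 < v a then t (D.comp i) l b * t (D.comp j) b r else t (D.comp i) f r
    else if 0 < v a then t (D.comp j) b r else 1
  refine ⟨fun a => M a ((M q).symm s), fun p' hp' => ?_, by simp⟩
  generalize (M q).symm s = z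
  obtain ⟨⟨e1, e2, e3⟩, s1, s2, s3, s4⟩ := hV p' hp'
  have upos : 0 < u p' → ∀ᶠ a in 𝓝 p', 0 < u a := fun h => hu.continuousAt.eventually_const_lt h
  have uneg : u p' < 0 → ∀ᶠ a in 𝓝 p', u a < 0 := fun h => hu.continuousAt.eventually_lt_const h
  have vpos : 0 < v p' → ∀ᶠ a in 𝓝 p', 0 < v a := fun h => hv.continuousAt.eventually_const_lt h
  have vneg : v p' < 0 → ∀ᶠ a in 𝓝 p', v a < 0 := fun h => hv.continuousAt.eventually_lt_const h
  have base : ∀ k, cross2 (D.dir k) (p' - p) = 0 → ∀ a, cross2 (D.dir k) (a - p') =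
      cross2 (D.dir k) (a - p) := fun k hk a => by
    rw [cross2_sub] at hk ⊢
    rw [cross2_sub]
    linarith
  refine ⟨fun hU => ?_, fun k Q' Q hs => ?_⟩
  · have hu0 : u p' ≠ 0 := fun h => mem_complement.1 hU i (e1.2 h)
    have hv0 : v p' ≠ 0 := fun h => mem_complement.1 hU j (e2.2 h)
    rcases hu0.lt_or_gt with h1 | h1 <;> rcases hv0.lt_or_gt with h2 | h2
    · filter_upwards [uneg h1, vneg h2] with a h3 h4
      simp [M, h1.not_gt, h2.not_gt, h3.not_gt, h4.not_gt]
    · filter_upwards [uneg h1, vpos h2] with a h3 h4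
      simp [M, h1.not_gt, h2, h3.not_gt, h4]
    · filter_upwards [upos h1, vneg h2] with a h3 h4
      simp [M, h1, h2.not_gt, h3, h4.not_gt]
    · filter_upwards [upos h1, vpos h2] with a h3 h4
      simp [M, h1, h2, h3, h4]
  · have hij := hc.crosses.1
    rcases e3 k hs.1.1 with rfl | rfl
    · have hu0 : u p' = 0 := e1.1 hs.1.1
      have hv0 : v p' ≠ 0 := fun h => hs.1.2 j hij.symm (e2.2 h)
      rcases hv0.lt_or_gt with h2 | h2
      · obtain ⟨rfl, rfl⟩ := Sides.unique hs (s2 hu0 h2)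
        refine ⟨z, ?_⟩
        filter_upwards [vneg h2] with a h4
        rw [base k hu0]
        exact ⟨fun h : 0 < u a => by simp [M, h, h4.not_gt],
          fun h : u a < 0 => by simp [M, h.not_gt, h4.not_gt]⟩
      · obtain ⟨rfl, rfl⟩ := Sides.unique hs (s1 hu0 h2)
        refine ⟨t (D.comp j) Q r z, ?_⟩
        filter_upwards [vpos h2] with a h4
        rw [base k hu0]
        exact ⟨fun h : 0 < u a => by simp [M, h, h4],
          fun h : u a < 0 => by simp [M, h.not_gt, h4]⟩
    · have hv0 : v p' = 0 := e2.1 hs.1.1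
      have hu0 : u p' ≠ 0 := fun h => hs.1.2 i hij (e1.2 h)
      rcases hu0.lt_or_gt with h2 | h2
      · obtain ⟨rfl, rfl⟩ := Sides.unique hs (s4 hv0 h2)
        refine ⟨z, ?_⟩
        filter_upwards [uneg h2] with a h4
        rw [base k hv0]
        exact ⟨fun h : 0 < v a => by simp [M, h, h4.not_gt],
          fun h : v a < 0 => by simp [M, h.not_gt, h4.not_gt]⟩
      · obtain ⟨rfl, rfl⟩ := Sides.unique hs (s3 hv0 h2)
        refine ⟨t (D.comp i) Q r z, ?_⟩
        filter_upwards [upos h2] with a h4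
        rw [base k hv0]
        exact ⟨fun h : 0 < v a => by simp [M, h, h4, ht i k p _ _ _ _ hc],
          fun h : v a < 0 => by simp [M, h.not_gt, h4]⟩

theorem exists_local_section (ht : IsFlat t) (p : ℝ × ℝ) :
    ∃ V, IsOpen V ∧ p ∈ V ∧ ∀ q ∈ V ∩ D.complement, ∀ s : S, ∃ G,
      (∀ p' ∈ V, IsSectionAt t G p') ∧ G q = s := by
  rcases D.point_cases p with h | ⟨i, h⟩ | ⟨i, h⟩ | ⟨i, j, hc, hi, hj, h⟩
  · exact exists_local_section_complement h
  · obtain ⟨R', R, h, hc⟩ := exists_strandChart (Or.inl h)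
    exact exists_local_section_strand hc
  · obtain ⟨R', R, h, hc⟩ := exists_strandChart (Or.inr h)
    exact exists_local_section_strand hc
  · obtain ⟨l, b, r, f, hc⟩ := exists_crossingChart hc hi hj h
    exact exists_local_section_crossing ht hc

/-- `G` follows the transitions `t` across all edges. -/
def IsSection (t : D.Component → D.Region → D.Region → Equiv.Perm S) (G : D.Region → S) : Prop :=
  ∀ i p R' R, D.Sides i p R' R → G R' = t (D.comp i) R' R (G R)

/-- Local sections patch over the plane, and the result is constant on regions because it is locally
constant on the complement. -/
theorem exists_isSection (ht : IsFlat t) (R₀ : D.Region) (s : S) :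
    ∃ G, IsSection t G ∧ G R₀ = s := by
  obtain ⟨q, hq⟩ := exists_mem_region R₀
  obtain ⟨g, hg, hgq⟩ := exists_global_section D.complement D.dense_complement (IsSectionAt t)
    (fun _ _ _ h hG => hG.congr h) (exists_local_section ht)
    (fun V hV hc G G' hG hG' q hq h a ha => IsSectionAt.eq_of_convex hV hc hG hG' hq h ha)
    q hq.1 s
  have hloc : IsLocallyConstant fun a : D.complement => g a := by
    rw [IsLocallyConstant.iff_eventually_eq]
    intro a
    exact continuous_subtype_val.continuousAt.eventually ((hg a).region a.2)
  have hconst : ∀ {a b R}, D.InRegion a R → D.InRegion b R → g a = g b := by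
    rintro a b R ⟨ha, h1⟩ ⟨hb, h2⟩
    have h := ConnectedComponents.coe_eq_coe'.1 (h1.trans h2.symm)
    exact hloc.apply_eq_of_isPreconnected isPreconnected_connectedComponent h
      mem_connectedComponent
  choose pt hpt using exists_mem_region (P := D.toOrientedPolygons)
  refine ⟨fun R => g (pt R), fun i p R' R hs => ?_, (hconst (hpt _) hq).trans hgq⟩
  obtain ⟨z, hz⟩ := (hg p).edge i R' R hs
  obtain ⟨a, h1, h2⟩ := Sides.exists_left hs (hz.mono fun _ h => h.1)
  obtain ⟨b, h3, h4⟩ := Sides.exists_right hs (hz.mono fun _ h => h.2)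
  simp only
  rw [hconst (hpt R') h1, hconst (hpt R) h3, h2, h4]

theorem IsSection.eq {G G' : D.Region → S} (hG : IsSection t G) (hG' : IsSection t G')
    {R₀ : D.Region} (h : G R₀ = G' R₀) : G = G' := by
  classical
  -- The value given to points on the edges is immaterial: `IsSectionAt` tests only points off the
  -- diagram.
  let ex : (D.Region → S) → ℝ × ℝ → S := fun F a =>
    if h : a ∈ D.complement then F (ConnectedComponents.mk (⟨a, h⟩ : D.complement)) else F R₀
  have hex : ∀ {F a R}, D.InRegion a R → ex F a = F R := by
    rintro F a R ⟨h, rfl⟩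
    simp only [ex]
    rw [dif_pos h]
  have hsec : ∀ F, IsSection t F → ∀ p, IsSectionAt t (ex F) p := by
    intro F hF p
    refine ⟨fun hp => ?_, fun i R' R hs => ⟨F R, ?_⟩⟩
    · obtain ⟨R, hR⟩ := exists_inRegion hp
      filter_upwards [hR.eventually] with a ha
      rw [hex ha, hex hR]
    · filter_upwards [hs.2] with a ha
      exact ⟨fun h => by rw [hex (ha.1 h), hF i p R' R hs], fun h => hex (ha.2 h)⟩
  funext R
  obtain ⟨q, hq⟩ := exists_mem_region R₀
  obtain ⟨a, ha⟩ := exists_mem_region R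
  have := IsSectionAt.eq_of_convex isOpen_univ convex_univ (fun p _ => hsec G hG p)
    (fun p _ => hsec G' hG' p) ⟨mem_univ q, hq.1⟩ (by rw [hex hq, hex hq, h]) ⟨mem_univ a, ha.1⟩
  rwa [hex ha, hex ha] at this

theorem nonempty_region : Nonempty D.Region := by
  obtain ⟨a, ha⟩ := D.dense_complement.nonempty
  exact ⟨(exists_inRegion ha).choose⟩

/-- `p` is an accumulation point of its edge, and the multiple points other than `p` stay away from
it. -/
theorem exists_simpleOn_near {i : D.Edge} {p : ℝ × ℝ} (hp : p ∈ D.side i) {Q : ℝ × ℝ → Prop}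
    (hQ : ∀ᶠ a in 𝓝 p, Q a) : ∃ a, D.SimpleOn i a ∧ Q a := by
  have hne : (D.side i).Nontrivial := ⟨_, start_mem_side i, _, end_mem_side i, fun h =>
    D.next_ne i (D.pt_injective h).symm⟩
  have hacc := (convex_segment (𝕜 := ℝ) (D.pt i) (D.pt (D.next i))).isPreconnected
    |>.preperfect_of_nontrivial hne p hp
  have hfin : (D.multiplePoints \ {p}).Finite := D.finite_multiplePoints.subset sdiff_subset
  have hZ : ∀ᶠ a in 𝓝 p, a ∉ D.multiplePoints \ {p} :=
    hfin.isClosed.isOpen_compl.mem_nhds (by simp)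
  obtain ⟨a, ⟨haQ, haZ⟩, hne, hai⟩ := (accPt_iff_nhds.1 hacc _ (hQ.and hZ)) |>.imp
    fun a h => (⟨h.1.1, h.2, h.1.2⟩ : (Q a ∧ a ∉ D.multiplePoints \ {p}) ∧ a ≠ p ∧ a ∈ D.side i)
  exact ⟨a, simpleOn_of_notMem_multiplePoints (fun h => haZ ⟨h, hne⟩) hai, haQ⟩

/-! ### Propagation of a relation along a component -/

/-- The relation `K` holds between the two sides of the edge `i`, everywhere. -/
def HoldsAlong (K : D.Region → D.Region → Prop) (i : D.Edge) : Prop :=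
  ∀ p R' R, D.Sides i p R' R → K R' R

/-- The truth value of `K` is locally constant along the edge: the two regions stay the same away
from crossings, and `h₁`, `h₂` compare the pairs before and after a crossing. The edge is connected.
-/
theorem holdsAlong_of_sides {K : D.Region → D.Region → Prop} {i : D.Edge}
    (h₁ : ∀ j p l b r f, CrossingChart i j p l b r f → (K l b ↔ K f r))
    (h₂ : ∀ j p l b r f, CrossingChart j i p l b r f → (K b r ↔ K l f))
    {p : ℝ × ℝ} {R' R : D.Region} (hs : D.Sides i p R' R) (hK : K R' R) : HoldsAlong K i := by
  have loc : ∀ p ∈ D.side i, ∃ κ : Prop,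
      ∀ᶠ a in 𝓝 p, ∀ R' R, D.Sides i a R' R → (K R' R ↔ κ) := by
    have strand : ∀ (k : D.Edge) p Q' Q h, StrandChart k p Q' Q h → ∃ κ : Prop,
      ∀ᶠ a in 𝓝 p, ∀ R' R, D.Sides i a R' R → (K R' R ↔ κ) := by
      intro k p Q' Q h hc
      refine ⟨K Q' Q, ?_⟩
      filter_upwards [hc.sides] with a ha R' R hs
      obtain ⟨rfl, rfl⟩ := Sides.unique hs (ha i hs.1).2.1
      rfl
    intro p hp
    rcases D.point_cases p with h | ⟨k, h⟩ | ⟨k, h⟩ | ⟨k, j, hc, hk, hj, h⟩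
    · exact absurd hp (mem_complement.1 h i)
    · obtain ⟨R', R, h, hc⟩ := exists_strandChart (Or.inl h)
      exact strand _ _ _ _ _ hc
    · obtain ⟨R', R, h, hc⟩ := exists_strandChart (Or.inr h)
      exact strand _ _ _ _ _ hc
    · obtain ⟨l, b, r, f, hc⟩ := exists_crossingChart hc hk hj h
      have hkj := hc.crosses.1
      by_cases hik : i = k
      · subst hik
        refine ⟨K l b, ?_⟩
        filter_upwards [hc.mem_side, hc.sides] with a ⟨e1, e2, _⟩ ⟨s1, s2, _, _⟩ R' R hs
        have hu := e1.1 hs.1.1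
        have hv : cross2 (D.dir j) (a - p) ≠ 0 := fun h => hs.1.2 j hkj.symm (e2.2 h)
        rcases hv.lt_or_gt with hv | hv
        · obtain ⟨rfl, rfl⟩ := Sides.unique hs (s2 hu hv)
          exact (h₁ _ _ _ _ _ _ hc).symm
        · obtain ⟨rfl, rfl⟩ := Sides.unique hs (s1 hu hv)
          rfl
      · by_cases hij : i = j
        · subst hij
          refine ⟨K b r, ?_⟩
          filter_upwards [hc.mem_side, hc.sides] with a ⟨e1, e2, _⟩ ⟨_, _, s3, s4⟩ R' R hs
          have hv := e2.1 hs.1.1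
          have hu : cross2 (D.dir k) (a - p) ≠ 0 := fun h => hs.1.2 k hkj (e1.2 h)
          rcases hu.lt_or_gt with hu | hu
          · obtain ⟨rfl, rfl⟩ := Sides.unique hs (s4 hv hu)
            rfl
          · obtain ⟨rfl, rfl⟩ := Sides.unique hs (s3 hv hu)
            exact (h₂ _ _ _ _ _ _ hc).symm
        · rcases hc.mem_side.self_of_nhds.2.2 i hp with h | h
          · exact absurd h hik
          · exact absurd h hij
  let A : Set (ℝ × ℝ) := {p | ∀ᶠ a in 𝓝 p, ∀ R' R, D.Sides i a R' R → K R' R}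
  let B : Set (ℝ × ℝ) := {p | ∀ᶠ a in 𝓝 p, ∀ R' R, D.Sides i a R' R → ¬ K R' R}
  have hA : IsOpen A := isOpen_setOfPred_eventually_nhds
  have hB : IsOpen B := isOpen_setOfPred_eventually_nhds
  have hAB : D.side i ∩ (A ∩ B) = ∅ := by
    refine eq_empty_of_forall_notMem ?_
    rintro p ⟨hp, h1, h2⟩
    obtain ⟨a, ha, h3, h4⟩ := exists_simpleOn_near hp (h1.and h2)
    obtain ⟨R', R, hs⟩ := exists_sides ha
    exact h4 _ _ hs (h3 _ _ hs)
  have hcov : D.side i ⊆ A ∪ B := by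
    intro p hp
    obtain ⟨κ, hκ⟩ := loc p hp
    by_cases h : κ
    · exact Or.inl (hκ.mono fun a ha R' R hs => (ha R' R hs).2 h)
    · exact Or.inr (hκ.mono fun a ha R' R hs h' => h ((ha R' R hs).1 h'))
  have hpre : IsPreconnected (D.side i) := (convex_segment _ _).isPreconnected
  have hpA : p ∈ A := (hcov hs.1.1).resolve_right fun h => h.self_of_nhds _ _ hs hK
  intro q Q' Q hq
  rcases hcov hq.1.1 with h | h
  · exact h.self_of_nhds _ _ hq
  · obtain ⟨x, hx⟩ := hpre A B hA hB hcov ⟨p, hs.1.1, hpA⟩ ⟨q, hq.1.1, h⟩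
    exact absurd hx (by rw [hAB]; exact notMem_empty x)

/-- A relation between the two sides of the edges of a component that is preserved at its crossings
holds everywhere along the component, once it holds somewhere. -/
theorem holdsAlong_component {K : D.Region → D.Region → Prop} {k : D.Edge}
    (h₁ : ∀ i j p l b r f, D.comp i = D.comp k → CrossingChart i j p l b r f → (K l b ↔ K f r))
    (h₂ : ∀ i j p l b r f, D.comp j = D.comp k → CrossingChart i j p l b r f → (K b r ↔ K l f))
    {p : ℝ × ℝ} {R' R : D.Region} (hs : D.Sides k p R' R) (hK : K R' R) {i : D.Edge}
    (hi : D.comp i = D.comp k) : HoldsAlong K i := by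
  have edge : ∀ i, D.comp i = D.comp k → (∃ p R' R, D.Sides i p R' R ∧ K R' R) →
      HoldsAlong K i := by
    rintro i hi ⟨p, R', R, hs, hK⟩
    exact holdsAlong_of_sides (fun j p l b r f => h₁ i j p l b r f hi)
      (fun j p l b r f => h₂ j i p l b r f hi) hs hK
  have step : ∀ i, D.comp i = D.comp k → D.comp (D.next i) = D.comp k →
      (HoldsAlong K i ↔ HoldsAlong K (D.next i)) := by
    intro i hi hi'
    -- Around the common vertex both edges separate the same two regions.
    obtain ⟨Q', Q, h, hc⟩ := exists_strandChart_vertex i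
    obtain ⟨a, ha, h1⟩ := exists_simpleOn_near (end_mem_side i) hc.sides
    obtain ⟨b, hb, h2⟩ := exists_simpleOn_near (start_mem_side (D.next i)) hc.sides
    have h1 := (h1 _ ha).2.1
    have h2 := (h2 _ hb).2.1
    exact ⟨fun H => edge _ hi' ⟨b, Q', Q, h2, H _ _ _ h1⟩,
      fun H => edge _ hi ⟨a, Q', Q, h1, H _ _ _ h2⟩⟩
  obtain ⟨n, hn⟩ := (comp_eq_iff.1 hi.symm).exists_nat_pow_eq
  have hcomp : ∀ n : ℕ, D.comp ((D.next ^ n) k) = D.comp k := fun n =>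
    comp_eq_iff.2 (Equiv.Perm.SameCycle.symm ⟨n, by simp⟩)
  have : ∀ n : ℕ, HoldsAlong K ((D.next ^ n) k) := by
    intro n
    induction n with
    | zero => exact edge k rfl ⟨p, R', R, hs, hK⟩
    | succ n ih =>
      have hc := hcomp (n + 1)
      rw [pow_succ', Equiv.Perm.mul_apply] at hc ⊢
      exact (step _ (hcomp n) hc).1 ih
  exact hn ▸ this n

end LinkDiagram

/-! ### Algebra of virtual colors -/

namespace VerticalTribracket

variable {X : Type u} (T : VerticalTribracket X)

/-- The permutation `z ↦ z'` with `⟨z', x', x⟩ = z`. -/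
noncomputable def shift (x' x : X) : Equiv.Perm X :=
  (Equiv.ofBijective (fun z => T.br z x' x)
    ((Function.bijective_iff_existsUnique _).2 fun z => T.left_inv x' x z)).symm

theorem br_shift (x' x z : X) : T.br (T.shift x' x z) x' x = z :=
  (Equiv.ofBijective (fun z => T.br z x' x) _).apply_symm_apply z

variable {T}

theorem eq_shift_iff {x' x z z' : X} : z' = T.shift x' x z ↔ T.br z' x' x = z :=
  Equiv.eq_symm_apply _

theorem right_cancel {x y z z' : X} (h : T.br x y z = T.br x y z') : z = z' :=
  (T.right_inv x y _).unique h rfl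

/-- With s the left-hand side, ⟨s, y, x⟩ = z, and the involution turns this into ⟨s, z, x⟩ = y. -/
theorem shift_eq_shift (hT : T.CenterInvolutory) (x y z : X) : T.shift y x z = T.shift z x y := by
  rw [eq_shift_iff]
  have h : T.br _ (T.br _ y x) x = y := hT (T.shift y x z) x y
  rwa [br_shift] at h

/-- This is the second exchange identity for `shift`: a strand can be carried from r to l on either
side of a crossing. -/
theorem shift_shift {l b r f : X} (h : f = T.br l b r) (z : X) :
    T.shift l b (T.shift b r z) = T.shift l f (T.shift f r z) := by
  rw [eq_shift_iff, eq_shift_iff, h, ← T.exchange₂, br_shift, br_shift]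

variable {K : Type*}

variable (T) in
/-- The color of a region together with the colors next to it across virtual edges, one for each
element of `K`, that have the region on their right; `step k` passes over the edge `k`. -/
noncomputable def step (k : K) : Equiv.Perm (X × (K → X)) := by
  refine Equiv.ofBijective (fun q => (q.2 k, fun j => T.shift (q.2 k) q.1 (q.2 j))) ⟨?_, ?_⟩
  · rintro ⟨x, y⟩ ⟨x', y'⟩ h
    obtain ⟨h1, h2⟩ := Prod.mk.inj h
    simp only at h1 h2
    -- The k-th entry of the image, together with y_k, determines `x` by solvability in the third
    -- place.
    have h3 : T.br (T.shift (y k) x (y k)) (y k) x = T.br (T.shift (y k) x (y k)) (y k) x' := by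
      rw [br_shift, congrFun h2 k, h1, br_shift]
    obtain rfl := right_cancel h3
    simp only [Prod.mk.injEq, true_and]
    funext j
    have h4 := congrFun h2 j
    rw [h1] at h4
    exact (T.shift _ _).injective h4
  · rintro ⟨x', y'⟩
    -- This `x` is forced: the k-th virtual color before the step has to be the color x' reached by
    -- it.
    obtain ⟨x, hx, -⟩ := T.right_inv (y' k) x' x'
    refine ⟨(x, fun j => T.br (y' j) x' x), ?_⟩
    simp only [hx, Prod.mk.injEq, true_and]
    funext j
    exact (eq_shift_iff.2 rfl).symm

theorem step_apply (k : K) (q : X × (K → X)) :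
    T.step k q = (q.2 k, fun j => T.shift (q.2 k) q.1 (q.2 j)) := rfl

/-- The two virtual edges form a crossing with r = x, b = y_j, f = y_i. Both orders give l the same
color by `shift_eq_shift`, and the other entries agree by `shift_shift` at this crossing. -/
theorem step_comm (hT : T.CenterInvolutory) (i j : K) (q : X × (K → X)) :
    T.step i (T.step j q) = T.step j (T.step i q) := by
  obtain ⟨x, y⟩ := q
  have h1 : T.shift (y j) x (y i) = T.shift (y i) x (y j) := shift_eq_shift hT _ _ _
  simp only [step_apply, Prod.mk.injEq]
  refine ⟨h1, funext fun k => ?_⟩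
  rw [h1]
  refine shift_shift ?_ _
  rw [← h1, br_shift]

end VerticalTribracket

/-! ### Colorings as sections -/

namespace LinkDiagram

open OrientedPolygons

variable {D : LinkDiagram} {X : Type u} {T : VerticalTribracket X}

theorem LeadsInto.unique {p d : ℝ × ℝ} {R R' : D.Region} (h : D.LeadsInto p d R)
    (h' : D.LeadsInto p d R') : R = R' := by
  obtain ⟨ε, h1, h2⟩ := (h.and h').exists
  exact InRegion.unique h1 h2

/-- In the center-involutory case the sign of a crossing does not matter. -/
def IsColoring (T : VerticalTribracket X) (C : D.Region → X) : Prop :=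
  ∀ i j p l b r f, CrossingChart i j p l b r f → C f = T.br (C l) (C b) (C r)

theorem Coloring.isColoring (hT : T.CenterInvolutory) (C : D.Coloring T) :
    IsColoring T C.color := by
  intro i j p l b r f hc
  obtain ⟨h1, h2, h3, h4⟩ := hc.leadsInto
  by_cases hu : D.upper i j
  · obtain ⟨l', b', r', f', g1, g2, g3, g4, e⟩ :=
      C.positive i j p hc.crosses hu ⟨hc.mem_left, hc.mem_right⟩ hc.pos
    rwa [LeadsInto.unique h1 g1, LeadsInto.unique h2 g2, LeadsInto.unique h3 g3,
      LeadsInto.unique h4 g4]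
  -- With `j` on top the crossing is negative and b = ⟨l, f, r⟩, equivalent to f = ⟨l, b, r⟩ by the
  -- involution.
  · have hu' : D.upper j i := by
      by_contra h
      exact hu ((D.upper_iff i j hc.crosses).2 h)
    obtain ⟨l', b', r', f', g1, g2, g3, g4, e⟩ := C.negative j i p (crosses_symm hc.crosses) hu'
      ⟨hc.mem_right, hc.mem_left⟩ (by rw [cross2_swap]; linarith [hc.pos])
    rw [neg_sub_comm] at g2
    rw [add_comm] at g4
    rw [LeadsInto.unique h1 g1, LeadsInto.unique h2 g2, LeadsInto.unique h3 g3,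
      LeadsInto.unique h4 g4, e]
    exact (hT _ _ _).symm

/-- The coloring with the given underlying function. -/
def coloringOf (hT : T.CenterInvolutory) (C : D.Region → X) (hC : IsColoring T C) :
    D.Coloring T where
  color := C
  positive := by
    intro i j p hij _ hp hpos
    obtain ⟨l, b, r, f, hc⟩ := exists_crossingChart hij hp.1 hp.2 hpos
    obtain ⟨h1, h2, h3, h4⟩ := hc.leadsInto
    exact ⟨l, b, r, f, h1, h2, h3, h4, hC _ _ _ _ _ _ _ hc⟩
  negative := by
    intro i j p hij _ hp hneg
    obtain ⟨l, b, r, f, hc⟩ := exists_crossingChart (crosses_symm hij) hp.2 hp.1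
      (by rw [cross2_swap]; linarith)
    obtain ⟨h1, h2, h3, h4⟩ := hc.leadsInto
    refine ⟨l, b, r, f, h1, by rwa [neg_sub_comm], h3, by rwa [add_comm], ?_⟩
    rw [hC _ _ _ _ _ _ _ hc]
    exact (hT _ _ _).symm

theorem CrossingChart.exists_sides {i j : D.Edge} {p : ℝ × ℝ} {l b r f : D.Region}
    (hc : CrossingChart i j p l b r f) : (∃ a, D.Sides i a l b) ∧ (∃ a, D.Sides i a f r) ∧
      (∃ a, D.Sides j a l f) ∧ ∃ a, D.Sides j a b r := by
  have hpos := hc.pos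
  have hji : cross2 (D.dir j) (D.dir i) < 0 := by rw [cross2_swap]; linarith
  refine ⟨?_, ?_, ?_, ?_⟩
  · obtain ⟨s, hs, h⟩ := exists_add_smul (-D.dir i) hc.sides
    refine ⟨_, h.1 ?_ ?_⟩ <;>
      simp only [add_sub_cancel_left, cross2_smul, cross2_neg, cross2_self] <;> nlinarith
  · obtain ⟨s, hs, h⟩ := exists_add_smul (D.dir i) hc.sides
    refine ⟨_, h.2.1 ?_ ?_⟩ <;>
      simp only [add_sub_cancel_left, cross2_smul, cross2_self] <;> nlinarith
  · obtain ⟨s, hs, h⟩ := exists_add_smul (D.dir j) hc.sides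
    refine ⟨_, h.2.2.1 ?_ ?_⟩ <;>
      simp only [add_sub_cancel_left, cross2_smul, cross2_self] <;> nlinarith
  · obtain ⟨s, hs, h⟩ := exists_add_smul (-D.dir j) hc.sides
    refine ⟨_, h.2.2.2 ?_ ?_⟩ <;>
      simp only [add_sub_cancel_left, cross2_smul, cross2_neg, cross2_self] <;> nlinarith

theorem isFlat_step (hT : T.CenterInvolutory) :
    IsFlat fun (k : D.Component) (_ _ : D.Region) => T.step k :=
  fun _ _ _ _ _ _ _ _ q => VerticalTribracket.step_comm hT _ _ q

theorem IsColoring.isFlat_shift {C : D.Region → X} (hC : IsColoring T C) :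
    IsFlat fun (_ : D.Component) (R' R : D.Region) => T.shift (C R') (C R) :=
  fun _ _ _ _ _ _ _ hc z => VerticalTribracket.shift_shift (hC _ _ _ _ _ _ _ hc) z

/-- Going from r through b to l gives l the color solving ⟨l, b, r⟩ = y_i, where y_i, the i-th
virtual color at r, is the color of f. -/
theorem isColoring_of_isSection {σ : D.Region → X × (D.Component → X)}
    (hσ : IsSection (fun k _ _ => T.step k) σ) : IsColoring T fun R => (σ R).1 := by
  intro i j p l b r f hc
  obtain ⟨⟨a1, h1⟩, ⟨a2, h2⟩, ⟨a3, h3⟩, ⟨a4, h4⟩⟩ := hc.exists_sides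
  have e1 := hσ _ _ _ _ h1
  have e2 := hσ _ _ _ _ h2
  have e4 := hσ _ _ _ _ h4
  simp only [VerticalTribracket.step_apply] at e1 e2 e4
  simp only [e1, e2, e4]
  rw [VerticalTribracket.br_shift]

theorem exists_simpleOn (i : D.Edge) : ∃ p, D.SimpleOn i p :=
  (exists_simpleOn_near (start_mem_side i) (Q := fun _ => True) (by simp)).imp fun _ h => h.1

theorem exists_comp (k : D.Component) : ∃ i, D.comp i = k := Quotient.exists_rep k

/-- The k-th virtual color equals a real color to the right of any edge of k, and is transported
from there by shifts that depend only on the colors. -/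
theorem eq_of_fst_eq {σ σ' : D.Region → X × (D.Component → X)}
    (hσ : IsSection (fun k _ _ => T.step k) σ) (hσ' : IsSection (fun k _ _ => T.step k) σ')
    (h : ∀ R, (σ R).1 = (σ' R).1) : σ = σ' := by
  have hsec : ∀ τ : D.Region → X × (D.Component → X), IsSection (fun k _ _ => T.step k) τ →
      ∀ k, IsSection (fun (_ : D.Component) R' R => T.shift (τ R').1 (τ R).1)
        fun R => (τ R).2 k := by
    intro τ hτ k i p R' R hs
    have e := hτ i p R' R hs
    simp only [VerticalTribracket.step_apply] at e
    simp only [e]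
  have hk : ∀ k, (fun R => (σ R).2 k) = fun R => (σ' R).2 k := by
    intro k
    obtain ⟨i, rfl⟩ := exists_comp k
    obtain ⟨p, hp⟩ := exists_simpleOn i
    obtain ⟨R', R, hs⟩ := exists_sides hp
    have h2 := hsec σ' hσ' (D.comp i)
    simp only [← h] at h2
    refine (hsec σ hσ (D.comp i)).eq h2 (R₀ := R) ?_
    have e := congrArg Prod.fst (hσ i p R' R hs)
    have e' := congrArg Prod.fst (hσ' i p R' R hs)
    simp only [VerticalTribracket.step_apply] at e e'
    rw [← e, ← e', h]
  funext R
  exact Prod.ext (h R) (funext fun k => congrFun (hk k) R)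

/-- For each component a virtual color `G` is transported by the flat shifts of the coloring,
starting beside one edge with the real color across it. What remains is that `G` predicts the real
color across every edge of the component. -/
theorem IsColoring.exists_isSection {C : D.Region → X} (hC : IsColoring T C)
    (hT : T.CenterInvolutory) : ∃ σ : D.Region → X × (D.Component → X),
      IsSection (fun k _ _ => T.step k) σ ∧ ∀ R, (σ R).1 = C R := by
  have key : ∀ k : D.Component, ∃ G : D.Region → X,
      IsSection (fun (_ : D.Component) R' R => T.shift (C R') (C R)) G ∧
      ∀ i, D.comp i = k → HoldsAlong (fun R' R => G R = C R') i := by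
    intro k
    obtain ⟨i, rfl⟩ := exists_comp k
    obtain ⟨p, hp⟩ := exists_simpleOn i
    obtain ⟨R', R, hs⟩ := LinkDiagram.exists_sides hp
    obtain ⟨G, hG, hR⟩ := LinkDiagram.exists_isSection hC.isFlat_shift R (C R')
    -- The prediction survives a crossing whichever of the two strands is followed; following `j`
    -- uses the coloring rule with b and f exchanged, which is where the involution enters.
    have cross : ∀ {l b r f}, C f = T.br (C l) (C b) (C r) →
        G b = T.shift (C b) (C r) (G r) → G f = T.shift (C f) (C r) (G r) →
        (G b = C l ↔ G r = C f) ∧ (G r = C b ↔ G f = C l) := by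
      intro l b r f h hb hf
      have h' : T.br (C l) (C f) (C r) = C b := by rw [h]; exact hT _ _ _
      constructor
      · rw [hb, eq_comm, VerticalTribracket.eq_shift_iff, ← h, eq_comm]
      · rw [hf, eq_comm (b := C l), VerticalTribracket.eq_shift_iff, h', eq_comm]
    refine ⟨G, hG, fun j hj => holdsAlong_component ?_ ?_ hs hR hj⟩
    · intro i j p l b r f _ hc
      obtain ⟨-, ⟨a2, h2⟩, -, ⟨a4, h4⟩⟩ := hc.exists_sides
      exact (cross (hC _ _ _ _ _ _ _ hc) (hG _ _ _ _ h4) (hG _ _ _ _ h2)).1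
    · intro i j p l b r f _ hc
      obtain ⟨-, ⟨a2, h2⟩, -, ⟨a4, h4⟩⟩ := hc.exists_sides
      exact (cross (hC _ _ _ _ _ _ _ hc) (hG _ _ _ _ h4) (hG _ _ _ _ h2)).2
  choose G hG hK using key
  refine ⟨fun R => (C R, fun k => G k R), fun i p R' R hs => ?_, fun R => rfl⟩
  have e : G (D.comp i) R = C R' := hK _ i rfl p R' R hs
  simp only [VerticalTribracket.step_apply, e, Prod.mk.injEq, true_and]
  exact funext fun k => hG k i p R' R hs

/-- Colorings correspond to the values of the sections of the system `step` in one region. -/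
theorem nonempty_equiv_coloring (D : LinkDiagram) (hT : T.CenterInvolutory) :
    Nonempty (X × (D.Component → X) ≃ D.Coloring T) := by
  obtain ⟨R₀⟩ := nonempty_region (D := D)
  choose σ hσ hσ₀ using fun q : X × (D.Component → X) =>
    exists_isSection (isFlat_step (D := D) hT) R₀ q
  refine ⟨Equiv.ofBijective
    (fun q => coloringOf hT (fun R => (σ q R).1) (isColoring_of_isSection (hσ q))) ⟨?_, ?_⟩⟩
  · intro q q' h
    have h := congrArg Coloring.color h
    rw [← hσ₀ q, ← hσ₀ q', eq_of_fst_eq (hσ q) (hσ q') fun R => congrFun h R]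
  · intro C
    obtain ⟨τ, hτ, hC⟩ := (C.isColoring hT).exists_isSection hT
    refine ⟨τ R₀, ?_⟩
    have : σ (τ R₀) = τ := (hσ _).eq hτ (hσ₀ _)
    obtain ⟨c, h1, h2⟩ := C
    simp only [coloringOf, this, Coloring.mk.injEq]
    exact funext hC

/-! ### Counting -/

theorem finite_component : Finite D.Component := Quotient.finite _

open Cardinal in
theorem mk_coloring (D : LinkDiagram) (hT : T.CenterInvolutory) :
    #(D.Coloring T) = #X ^ (D.numComponents + 1) := by
  obtain ⟨e⟩ := nonempty_equiv_coloring D hT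
  have := finite_component (D := D)
  have h : (Nat.card D.Component : Cardinal.{0}) = #D.Component := Nat.cast_card
  rw [← e.cardinal_eq, mk_prod, mk_pi, prod_const, numComponents, pow_succ', ← h]
  simp

open Fin.NatCast in
theorem numComponents_unlink (c : ℕ) : (unlink c).numComponents = c := by
  let σ : Equiv.Perm (Fin c × Fin 3) := Equiv.prodCongr (Equiv.refl _) (Equiv.addRight 1)
  -- Adding 1 is transitive on `Fin 3`, so the cycles are exactly the triangles.
  have hfst : ∀ x y, Equiv.Perm.SameCycle σ x y ↔ x.1 = y.1 := by
    have hpow : ∀ (n : ℕ) (x : Fin c × Fin 3), (σ ^ n) x = (x.1, x.2 + (n : Fin 3)) := by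
      intro n x
      induction n with
      | zero =>
        rw [Nat.cast_zero, add_zero]
        rfl
      | succ n ih =>
        rw [pow_succ', Equiv.Perm.mul_apply, ih]
        change (x.1, x.2 + (n : Fin 3) + 1) = _
        rw [Nat.cast_succ, add_assoc]
    intro x y
    constructor
    · intro h
      obtain ⟨n, hn⟩ := h.exists_nat_pow_eq
      rw [← hn, hpow]
    · intro h
      have : ∀ s t : Fin 3, s + (((t - s : Fin 3).val : ℕ) : Fin 3) = t := by decide
      exact ⟨(y.2 - x.2 : Fin 3).val, by
        rw [zpow_natCast, hpow, this]
        exact Prod.ext h rfl⟩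
  have e : (unlink c).Component ≃ Fin c := by
    refine Equiv.ofBijective (Quotient.lift Prod.fst fun x y h => (hfst x y).1 h) ⟨?_, ?_⟩
    · intro a b
      induction a using Quotient.inductionOn with | h x => ?_
      induction b using Quotient.inductionOn with | h y => ?_
      intro h
      exact Quotient.sound ((hfst x y).2 h)
    · intro k
      exact ⟨Quotient.mk _ ((k, 0) : Fin c × Fin 3), rfl⟩
  rw [numComponents, Nat.card_congr e, Nat.card_fin]

end LinkDiagram

open Cardinal in
theorem mainTheorem1 {X : Type u} (T : VerticalTribracket X) (hT : T.CenterInvolutory)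
    (D : LinkDiagram) :
    #(D.Coloring T) = #((unlink D.numComponents).Coloring T) ∧
      #(D.Coloring T) = #X ^ (D.numComponents + 1) := by
  rw [LinkDiagram.mk_coloring D hT, LinkDiagram.mk_coloring (unlink _) hT,
    LinkDiagram.numComponents_unlink]
  exact ⟨rfl, rfl⟩
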